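/- **Setting.** Consider $n$ agents $i\in[n]$, a finite state space $\mathcal S$, finite nonempty action sets $\mathcal A_i$, $\mathcal A=\prod_{i}\mathcal A_i$, a horizon $H$, nominal kernels $P^0_{h,s,\boldsymbol a}\in\Delta(\mathcal S)$, rewards $r_{i,h}:\mathcal S\times\mathcal A\to[0,1]$ and uncertainty levels $\sigma_i\ge 0$. A joint (Markov) policy is $\pi=(\pi_h)_{h\in[H]}$ with $\pi_h:\mathcal S\to\Delta(\mathcal A)$; it is a product policy if $\pi_h(s)=\prod_i\pi_{i,h}(s)$ with $\pi_{i,h}(s)\in\Delta(\mathcal A_i)$. For a joint policy $\pi$ let $$P^{\pi_{-i}}_{h,s,a_i}=\mathbb E_{\boldsymbol a\sim\pi_h(\cdot\mid s,a_i)}\big[P^0_{h,s,\boldsymbol a}\big],$$ where the conditional law of $\boldsymbol a_{-i}$ given an action $a_i$ of probability zero is taken to be the marginal law of $\boldsymbol a_{-i}$ (so for product policies $P^{\pi_{-i}}_{h,s,a_i}=\mathbb E_{\boldsymbol a_{-i}\sim\pi_{-i,h}(s)}[P^0_{h,s,(a_i,\boldsymbol a_{-i})}]$ always). The others-integrated $(s,a_i)$-rectangular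 total-variation uncertainty set of agent $i$ is $$\mathcal U^{\sigma_i}(P^0,\pi)=\bigotimes_{h,s,a_i}\Big\{P\in\Delta(\mathcal S):\tfrac12\big\|P-P^{\pi_{-i}}_{h,s,a_i}\big\|_1\le\sigma_i\Big\}.$$ The robust value functions are $$V_{i,h}^{\pi,\sigma_i}(s)=\inf_{P\in\mathcal U^{\sigma_i}(P^0,\pi)}\mathbb E_{\pi,P}\Big[\sum_{t=h}^H r_{i,t}(s_t,\boldsymbol a_t)\,\Big|\,s_h=s\Big],\qquad V_{i,h}^{\star,\pi_{-i},\sigma_i}(s)=\sup_{\pi_i':\mathcal S\times[H]\to\Delta(\mathcal A_i)}V_{i,h}^{\pi_i'\times\pi_{-i},\sigma_i}(s),$$ where $\boldsymbol a_t\sim\pi_t(s_t)$, $s_{t+1}\sim P_{t,s_t,a_{i,t}}$, and $\pi_{-i}$ is the marginal of $\pi$ on the actions of the other agents. A product policy $\pi$ is a *robust Nash equilibrium* (NE) if $V_{i,h}^{\pi,\sigma_i}(s)=V_{i,h}^{\star,\pi_{-i},\sigma_i}(s)$ for all $(i,h,s)\in[n]\times[H]\times\mathcal S$. A joint policy $\pi$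 is a *robust coarse correlated equilibrium* (CCE) if $V_{i,h}^{\pi,\sigma_i}(s)\ge V_{i,h}^{\star,\pi_{-i},\sigma_i}(s)$ for all $(i,h,s)$, and a *robust correlated equilibrium* (CE) if $V_{i,h}^{\pi,\sigma_i}(s)\ge V_{i,h}^{f_i\diamond\pi,\sigma_i}(s)$ for all $(i,h,s)$ and all strategy modifications $f_i=(f_{i,h,s}:\mathcal A_i\to\mathcal A_i)_{h,s}$, where $f_i\diamond\pi$ draws $\boldsymbol a\sim\pi_h(s)$ and replaces $a_i$ by $f_{i,h,s}(a_i)$. A discrete distribution $\xi$ over product policies is a robust CCE (respectively CE) if for all $(i,h,s)$ one has $\mathbb E_{\pi\sim\xi}[V_{i,h}^{\pi,\sigma_i}(s)]\ge\mathbb E_{\pi\sim\xi}[V_{i,h}^{\star,\pi_{-i},\sigma_i}(s)]$ (respectively $\mathbb E_{\pi\sim\xi}[V_{i,h}^{\pi,\sigma_i}(s)]\ge\mathbb E_{\pi\sim\xi}[V_{i,h}^{f_i\diamond\pi,\sigma_i}(s)]$ for every $f_i$). **Theorem.** Every such game has a robust Nash equilibrium, that is, a product policy $\pi$ with $$V_{i,h}^{\pi,\sigma_i}(s)=V_{i,h}^{\star,\pi_{-i},\sigma_i}(s)\qquad\text{for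 all }(i,h,s)\in[n]\times[H]\times\mathcal S.$$ Moreover every robust Nash equilibrium is a robust CE and a robust CCE, both as a joint policy and as a point mass on product policies; hence robust CE and robust CCE exist as well, in both forms. -/

import Mathlib

open Finset

noncomputable section

namespace RMG

/-- A finite-horizon fictitious robust Markov game with agents `N`, states `S`, action sets `A i`
and horizon `H` (steps are `0, …, H - 1`). `nominal h s a` is the nominal next-state distribution,
`reward i h s a` the reward of agent `i`, and `radius i` the uncertainty level of agent `i`. -/
structure Game (N S : Type*) (A : N → Type*) (H : ℕ) [Fintype S] where
  nominal : Fin H → S → (∀ i, A i) → stdSimplex ℝ S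
  reward : N → Fin H → S → (∀ i, A i) → ℝ
  reward_mem : ∀ i h s a, reward i h s a ∈ Set.Icc (0 : ℝ) 1
  radius : N → ℝ
  radius_nonneg : ∀ i, 0 ≤ radius i

section Policies

variable (N S : Type*) (A : N → Type*) (H : ℕ) [Fintype N] [DecidableEq N] [∀ i, Fintype (A i)]

/-- A Markov policy of agent `i`. -/
abbrev AgentPolicy (i : N) : Type _ := Fin H → S → stdSimplex ℝ (A i)

/-- A (possibly correlated) joint Markov policy. -/
abbrev JointPolicy : Type _ := Fin H → S → stdSimplex ℝ (∀ i, A i)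

/-- A product Markov policy: one Markov policy per agent. -/
abbrev ProductPolicy : Type _ := ∀ i, AgentPolicy N S A H i

/-- A strategy modification of agent `i`: it replaces the recommended action, depending on the
step and the current state. -/
abbrev StrategyModification (i : N) : Type _ := Fin H → S → A i → A i

end Policies

section JointOperations

variable {N S : Type*} {A : N → Type*} {H : ℕ}

/-- Exchange of the `i`-th coordinate of a joint action with a separate action of agent `i`. -/
def swapAt [DecidableEq N] (i : N) : ((∀ j, A j) × A i) ≃ ((∀ j, A j) × A i) where
  toFun p := (Function.update p.1 i p.2, p.1 i)
  invFun p := (Function.update p.1 i p.2, p.1 i)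
  left_inv p := by simp
  right_inv p := by simp

variable [Fintype N] [DecidableEq N] [∀ i, Fintype (A i)]

theorem sum_swapAt (i : N) (F : (∀ j, A j) → A i → ℝ) :
    ∑ a, ∑ b, F (Function.update a i b) (a i) = ∑ a, ∑ b, F a b := by
  simp only [← Fintype.sum_prod_type']
  exact Fintype.sum_equiv (swapAt i) _ _ (fun p => rfl)

/-- The joint policy `π₁ × ⋯ × πₙ` of independently acting agents. -/
def ProductPolicy.toJoint (π : ProductPolicy N S A H) : JointPolicy N S A H := fun h s =>
  ⟨fun a => ∏ i, (π i h s).1 (a i),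
    fun a => prod_nonneg fun i _ => (π i h s).2.1 (a i), by
      rw [← Fintype.piFinset_univ, ← prod_univ_sum]
      exact prod_eq_one fun i _ => (π i h s).2.2⟩

/-- The marginal probability that agent `i` plays `ai`. -/
def agentMarginal [∀ i, DecidableEq (A i)] (π : JointPolicy N S A H) (i : N) (h : Fin H) (s : S)
    (ai : A i) : ℝ :=
  ∑ a, if a i = ai then (π h s).1 a else 0

/-- The marginal probability that the agents other than `i` play `a₋ᵢ`
(the `i`-th coordinate of `a` is irrelevant). -/
def othersMarginal (π : JointPolicy N S A H) (i : N) (h : Fin H) (s : S) (a : ∀ j, A j) : ℝ :=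
  ∑ b : A i, (π h s).1 (Function.update a i b)

/-- The conditional probability `π_h(a₋ᵢ | s, aᵢ)` that the others play `a₋ᵢ` given that agent `i`
plays `aᵢ = a i`. If agent `i` never plays `aᵢ`, the conditional law is taken to be the marginal law
of `a₋ᵢ`; for a product policy this always gives `∏_{j ≠ i} π_{j,h}(a_j | s)`. -/
def othersConditional [∀ i, DecidableEq (A i)] (π : JointPolicy N S A H) (i : N) (h : Fin H) (s : S)
    (a : ∀ j, A j) : ℝ :=
  if agentMarginal π i h s (a i) = 0 then othersMarginal π i h s a
  else (π h s).1 a / agentMarginal π i h s (a i)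

/-- The joint policy `π'ᵢ × π₋ᵢ`: agent `i` plays `π'` independently of the others, who follow their
joint marginal of `π`. -/
def deviate (π : JointPolicy N S A H) (i : N) (π' : AgentPolicy N S A H i) : JointPolicy N S A H :=
  fun h s => ⟨fun a => (π' h s).1 (a i) * othersMarginal π i h s a,
    fun a => mul_nonneg ((π' h s).2.1 _) (sum_nonneg fun _ _ => (π h s).2.1 _), by
      simp only [othersMarginal, mul_sum]
      rw [sum_swapAt i (fun a b => (π' h s).1 b * (π h s).1 a)]
      simp_rw [← sum_mul, (π' h s).2.2, one_mul]
      exact (π h s).2.2⟩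

/-- The joint policy `f ⋄ π`: sample `a` from `π`, then replace `aᵢ` by `f_{h,s}(aᵢ)`. -/
def modify [∀ i, DecidableEq (A i)] (π : JointPolicy N S A H) (i : N)
    (f : StrategyModification N S A H i) : JointPolicy N S A H :=
  fun h s => ⟨fun a => ∑ b : A i, if f h s b = a i then (π h s).1 (Function.update a i b) else 0,
    fun a => sum_nonneg fun b _ => by split_ifs; exacts [(π h s).2.1 _, le_rfl], by
      have := sum_swapAt i (fun a b => if f h s (a i) = b then (π h s).1 a else 0)
      simp only [Function.update_self] at this
      rw [this]
      simpa using (π h s).2.2⟩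

end JointOperations

/-- Total variation distance between two probability vectors. -/
def tvDist {X : Type*} [Fintype X] (p q : X → ℝ) : ℝ := (1 / 2) * ∑ x, |p x - q x|

/-- Sequence of states `s_h, s_{h+1}, …` visited by a trajectory that starts in `s` and is recorded
as the list `ω` of (joint action, next state) pairs. -/
def statePath {X S : Type*} {m : ℕ} (s : S) (ω : Fin m → X × S) : Fin (m + 1) → S :=
  Fin.cons s fun k => (ω k).2

/-- The step `h + k` of the game, for `k < H - h`. -/
def stepAt {H : ℕ} (h : ℕ) (k : Fin (H - h)) : Fin H := ⟨h + k, by omega⟩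

namespace Game

variable {N S : Type*} {A : N → Type*} {H : ℕ} [Fintype S] [Fintype N] [DecidableEq N]
  [∀ i, Fintype (A i)]

/-- A trajectory from step `h` to the end of the horizon: the joint actions and next states. -/
abbrev Trajectory (N S : Type*) (A : N → Type*) (H h : ℕ) : Type _ :=
  Fin (H - h) → (∀ i : N, A i) × S

/-- Probability of the trajectory `ω` started at step `h` in `s`, when actions are drawn from the
joint policy `π` and, from the viewpoint of agent `i`, next states from the kernel `P_t(· | s, aᵢ)`. -/
def trajectoryProb (i : N) (π : JointPolicy N S A H) (P : Fin H → S → A i → stdSimplex ℝ S)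
    (h : ℕ) (s : S) (ω : Trajectory N S A H h) : ℝ :=
  ∏ k, (π (stepAt h k) (statePath s ω k.castSucc)).1 (ω k).1 *
    (P (stepAt h k) (statePath s ω k.castSucc) ((ω k).1 i)).1 (statePath s ω k.succ)

/-- Expected cumulative reward `E[∑_{t ≥ h} r_{i,t}(s_t, a_t) | s_h = s]` of agent `i` under the joint
policy `π` and the kernel `P`. -/
def value (G : Game N S A H) (i : N) (π : JointPolicy N S A H)
    (P : Fin H → S → A i → stdSimplex ℝ S) (h : ℕ) (s : S) : ℝ :=
  ∑ ω : Trajectory N S A H h, trajectoryProb i π P h s ω *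
    ∑ k, G.reward i (stepAt h k) (statePath s ω k.castSucc) (ω k).1

variable [∀ i, DecidableEq (A i)]

/-- Expected nominal kernel `P^{π₋ᵢ}_{h,s,aᵢ} = E_{a ∼ π_h(· | s, aᵢ)} [P⁰_{h,s,a}]`. -/
def nominalGiven (G : Game N S A H) (i : N) (π : JointPolicy N S A H) (h : Fin H) (s : S)
    (ai : A i) (s' : S) : ℝ :=
  ∑ a, if a i = ai then othersConditional π i h s a * (G.nominal h s a).1 s' else 0

/-- The others-integrated `(s, aᵢ)`-rectangular uncertainty set of agent `i`: the product over
`(h, s, aᵢ)` of the total variation balls of radius `σᵢ` around the expected nominal kernel. -/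
def uncertaintySet (G : Game N S A H) (i : N) (π : JointPolicy N S A H) :
    Set (Fin H → S → A i → stdSimplex ℝ S) :=
  {P | ∀ h s ai, tvDist (P h s ai).1 (G.nominalGiven i π h s ai) ≤ G.radius i}

/-- Robust value function `V_{i,h}^{π,σᵢ}(s)`: worst-case value over the uncertainty set. -/
def robustValue (G : Game N S A H) (i : N) (π : JointPolicy N S A H) (h : ℕ) (s : S) : ℝ :=
  ⨅ P : G.uncertaintySet i π, G.value i π P.1 h s

/-- Optimal robust value `V_{i,h}^{⋆,π₋ᵢ,σᵢ}(s)` of agent `i` against `π₋ᵢ`. -/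
def bestResponseValue (G : Game N S A H) (i : N) (π : JointPolicy N S A H) (h : ℕ) (s : S) : ℝ :=
  ⨆ π' : AgentPolicy N S A H i, G.robustValue i (deviate π i π') h s

/-- Robust Nash equilibrium (a product policy). -/
def IsRobustNE (G : Game N S A H) (π : ProductPolicy N S A H) : Prop :=
  ∀ (i : N) (h : Fin H) (s : S),
    G.robustValue i π.toJoint h s = G.bestResponseValue i π.toJoint h s

/-- Robust coarse correlated equilibrium (a joint policy). -/
def IsRobustCCE (G : Game N S A H) (π : JointPolicy N S A H) : Prop :=
  ∀ (i : N) (h : Fin H) (s : S), G.bestResponseValue i π h s ≤ G.robustValue i π h s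

/-- Robust correlated equilibrium (a joint policy). -/
def IsRobustCE (G : Game N S A H) (π : JointPolicy N S A H) : Prop :=
  ∀ (i : N) (f : StrategyModification N S A H i) (h : Fin H) (s : S),
    G.robustValue i (modify π i f) h s ≤ G.robustValue i π h s

/-- Expectation of `F π` for a random product policy `π ∼ ξ`. -/
def expect (ξ : PMF (ProductPolicy N S A H)) (F : ProductPolicy N S A H → ℝ) : ℝ :=
  ∑' π, (ξ π).toReal * F π

/-- Robust coarse correlated equilibrium, for a distribution `ξ` over product policies:
`E_{π ∼ ξ}[V^{⋆,π₋ᵢ}] ≤ E_{π ∼ ξ}[V^π]`. -/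
def IsMixedRobustCCE (G : Game N S A H) (ξ : PMF (ProductPolicy N S A H)) : Prop :=
  ∀ (i : N) (h : Fin H) (s : S),
    expect ξ (fun π => G.bestResponseValue i π.toJoint h s) ≤
      expect ξ (fun π => G.robustValue i π.toJoint h s)

/-- Robust correlated equilibrium, for a distribution `ξ` over product policies:
`E_{π ∼ ξ}[V^{f ⋄ π}] ≤ E_{π ∼ ξ}[V^π]` for every strategy modification `f`. -/
def IsMixedRobustCE (G : Game N S A H) (ξ : PMF (ProductPolicy N S A H)) : Prop :=
  ∀ (i : N) (f : StrategyModification N S A H i) (h : Fin H) (s : S),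
    expect ξ (fun π => G.robustValue i (modify π.toJoint i f) h s) ≤
      expect ξ (fun π => G.robustValue i π.toJoint h s)

end Game

end RMG

end

/-! Under a product policy the others' actions have the same law whatever agent `i` plays, even
given an action of probability zero. Hence the uncertainty set is a product of balls determined by
the others alone. One kernel is worst at all steps and states at once, and robust values obey a
Bellman recursion (`robustValue_toJoint`). Against fixed opponents each agent thus faces a robust
decision problem with a one-shot deviation principle (`isRobustNE_of_robustQ_le`): it suffices that
no single action at any `(i, h, s)` beats the value there.

To achieve this everywhere simultaneously, each triple `(i, h, s)` is made a separate player whose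
pure payoffs are `robustQ` with continuation `backwardValue`. A total variation ball moves no
farther than its centre, so these payoffs are continuous in the policy (`continuous_worstCase`), and
Nash's fixed-point argument applies (`exists_equilibrium`).

The Brouwer theorem behind it comes from Scarf's lemma, a door-counting parity argument. Applied to
grid points it gives approximate fixed points, compactness gives exact ones, and a product of
simplices is a retract of one simplex.

Finally, independent deviations and strategy modifications of a product policy are both unilateral
changes of one agent's policy, so a Nash equilibrium is a CE and a CCE. -/

namespace Scarf

/-! ### Scarf's lemma by door counting. -/

variable {T I : Type*} {r : I → T → ℤ}

/-- A set `σ` is dominating for the family of orders induced by the rankings `r i` if no element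
lies strictly above the `i`-th minimum of `σ` for all `i` at once. -/
def Dominating (r : I → T → ℤ) (σ : Finset T) : Prop := ∀ t, ∃ i, ∀ x ∈ σ, r i t ≤ r i x

theorem Dominating.mono {σ τ : Finset T} (hσ : Dominating r σ) (h : τ ⊆ σ) : Dominating r τ :=
  fun t => (hσ t).imp fun _ hi x hx => hi x (h hx)

/-- `x` is the `i`-highest element that lies above the `j`-th threshold `m j` for all `j ≠ i`. -/
def IsReplacement (r : I → T → ℤ) (m : I → T) (i : I) (x : T) : Prop :=
  (∀ j, j ≠ i → r j (m j) < r j x) ∧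
    ∀ t, (∀ j, j ≠ i → r j (m j) < r j t) → r i t ≤ r i x

theorem IsReplacement.unique {m : I → T} {i : I} (hr : Function.Injective (r i)) {x y : T}
    (hx : IsReplacement r m i x) (hy : IsReplacement r m i y) : x = y :=
  hr (le_antisymm (hy.2 x hx.1) (hx.2 y hy.1))

theorem exists_isReplacement [Finite T] {m : I → T} {i : I}
    (h : ∃ x, ∀ j, j ≠ i → r j (m j) < r j x) : ∃ x, IsReplacement r m i x := by
  obtain ⟨x, hx, hmax⟩ := Set.exists_max_image {x | ∀ j, j ≠ i → r j (m j) < r j x} (r i)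
    (Set.toFinite _) h
  exact ⟨x, hx, hmax⟩

theorem exists_minimizers (r : I → T → ℤ) {τ : Finset T} (hτ : τ.Nonempty) :
    ∃ m : I → T, ∀ i, m i ∈ τ ∧ ∀ x ∈ τ, r i (m i) ≤ r i x := by
  choose m hm using fun i => τ.exists_min_image (r i) hτ
  exact ⟨m, hm⟩

variable [Fintype I] [DecidableEq T]

/-- The minimizers of a dominating set exhaust it. -/
theorem Dominating.image_minimizers (hr : ∀ i, Function.Injective (r i)) {τ : Finset T}
    (hτ : Dominating r τ) {m : I → T} (hm : ∀ i, m i ∈ τ ∧ ∀ x ∈ τ, r i (m i) ≤ r i x) :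
    univ.image m = τ := by
  ext x
  simp only [mem_image, mem_univ, true_and]
  constructor
  · rintro ⟨i, rfl⟩
    exact (hm i).1
  · intro hx
    obtain ⟨i, hi⟩ := hτ x
    exact ⟨i, hr i (le_antisymm ((hm i).2 x hx) (hi _ (hm i).1))⟩

/-- The ways to extend a dominating set with one element too few: at most one way for each of two
distinguished indices. -/
theorem Dominating.exists_extension_iff (hr : ∀ i, Function.Injective (r i)) {τ : Finset T}
    (hτ : Dominating r τ) (hcard : τ.card + 1 = Fintype.card I) {m : I → T}
    (hm : ∀ i, m i ∈ τ ∧ ∀ x ∈ τ, r i (m i) ≤ r i x) :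
    ∃ i j, i ≠ j ∧ m i = m j ∧ ∀ x, (x ∉ τ ∧ Dominating r (insert x τ)) ↔
      (IsReplacement r m i x ∨ IsReplacement r m j x) := by
  classical
  obtain ⟨i₀, -, j₀, -, hij, hmij⟩ := exists_ne_map_eq_of_card_lt_of_maps_to
    (s := (univ : Finset I)) (t := τ) (f := m) (by rw [card_univ]; omega) (fun i _ => (hm i).1)
  refine ⟨i₀, j₀, hij, hmij, fun x => ⟨?_, ?_⟩⟩
  · rintro ⟨hx, hdom⟩
    -- These are the minimizers of `insert x τ`. They exhaust a set of `card I` elements, so they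
    -- are pairwise distinct and exactly one index `i` has minimizer `x`.
    let m' : I → T := fun k => if r k x < r k (m k) then x else m k
    have hm' : ∀ i, m' i ∈ insert x τ ∧ ∀ y ∈ insert x τ, r i (m' i) ≤ r i y := by
      intro i
      by_cases h : r i x < r i (m i)
      · simp only [m', h, if_true, mem_insert_self, true_and, mem_insert, forall_eq_or_imp, le_refl]
        exact fun y hy => h.le.trans ((hm i).2 y hy)
      · simp only [m', h, if_false, mem_insert, forall_eq_or_imp]
        exact ⟨Or.inr (hm i).1, not_lt.1 h, (hm i).2⟩
    have himg := hdom.image_minimizers hr hm'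
    have hinj : Function.Injective m' := by
      refine Set.injOn_univ.1 ?_
      rw [← coe_univ, ← card_image_iff, himg, card_insert_of_notMem hx, hcard, card_univ]
    obtain ⟨i, hi⟩ : ∃ i, m' i = x := by
      have : x ∈ univ.image m' := himg ▸ mem_insert_self _ _
      simpa using this
    have hlt : ∀ k, m' k = x ↔ r k x < r k (m k) := by
      intro k
      by_cases h : r k x < r k (m k)
      · simp [m', h]
      · simp only [m', h, if_false, iff_false]
        exact fun h' => hx (h' ▸ (hm k).1)
    have hother : ∀ j, j ≠ i → r j (m j) < r j x := by
      intro j hj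
      have h1 : ¬ r j x < r j (m j) := fun h => hj (hinj (((hlt j).2 h).trans hi.symm))
      refine lt_of_le_of_ne (not_lt.1 h1) fun h => hx ?_
      rw [← hr j h]
      exact (hm j).1
    have hrep : IsReplacement r m i x := by
      refine ⟨hother, fun t ht => ?_⟩
      obtain ⟨k, hk⟩ := hdom t
      by_cases hki : k = i
      · subst hki
        exact hk x (mem_insert_self _ _)
      · exact absurd (hk _ (mem_insert_of_mem (hm k).1)) (not_le.2 (ht k hki))
    -- Otherwise both coinciding minimizers `m i₀ = m j₀` would survive in `m'`, against
    -- injectivity.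
    have hcase : i = i₀ ∨ i = j₀ := by
      by_contra! hne
      have h1 : m' i₀ = m i₀ := if_neg (not_lt.2 (hother i₀ hne.1.symm).le)
      have h2 : m' j₀ = m j₀ := if_neg (not_lt.2 (hother j₀ hne.2.symm).le)
      exact hij (hinj (by rw [h1, h2, hmij]))
    rcases hcase with rfl | rfl
    exacts [Or.inl hrep, Or.inr hrep]
  · intro h
    obtain ⟨i, i', hii, hmii, hrep⟩ : ∃ i i', i' ≠ i ∧ m i = m i' ∧ IsReplacement r m i x := by
      rcases h with h | h
      exacts [⟨i₀, j₀, hij.symm, hmij, h⟩, ⟨j₀, i₀, hij, hmij.symm, h⟩]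
    -- Since `x` passes every threshold other than the `i`-th, domination by `τ` can hold for `x`
    -- only in order `i`.
    have hself : r i x ≤ r i (m i) := by
      obtain ⟨k, hk⟩ := hτ x
      by_cases hki : k = i
      · subst hki
        exact hk _ (hm k).1
      · exact absurd (hk _ (hm k).1) (not_le.2 (hrep.1 k hki))
    refine ⟨fun hx => ?_, fun t => ?_⟩
    · have hxm : x = m i := hr i (le_antisymm hself ((hm i).2 x hx))
      have := hrep.1 i' hii
      rw [← hmii, ← hxm] at this
      exact lt_irrefl _ this
    · by_cases ht : ∀ j, j ≠ i → r j (m j) < r j t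
      · have h1 := hrep.2 t ht
        refine ⟨i, fun y hy => ?_⟩
        rcases mem_insert.1 hy with rfl | hy
        exacts [h1, (h1.trans hself).trans ((hm i).2 y hy)]
      · push Not at ht
        obtain ⟨j, hj, hle⟩ := ht
        refine ⟨j, fun y hy => ?_⟩
        rcases mem_insert.1 hy with rfl | hy
        exacts [hle.trans (hrep.1 j hj).le, hle.trans ((hm j).2 y hy)]

open Classical in
/-- Number of dominating extensions of a set by one element. -/
theorem card_extensions [Fintype T] (hr : ∀ i, Function.Injective (r i)) {τ : Finset T}
    {m : I → T} {i j : I} (hij : i ≠ j)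
    (h : ∀ x, (x ∉ τ ∧ Dominating r (insert x τ)) ↔
      (IsReplacement r m i x ∨ IsReplacement r m j x))
    (hτ : Dominating r τ) (hm : ∀ i, m i ∈ τ ∧ ∀ x ∈ τ, r i (m i) ≤ r i x)
    (hi : ∃ x, ∀ k, k ≠ i → r k (m k) < r k x) :
    (univ.filter fun x => x ∉ τ ∧ Dominating r (insert x τ)).card =
      if ∃ x, ∀ k, k ≠ j → r k (m k) < r k x then 2 else 1 := by
  obtain ⟨x, hx⟩ := exists_isReplacement hi
  split_ifs with hj
  · obtain ⟨y, hy⟩ := exists_isReplacement hj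
    have hxy : x ≠ y := by
      rintro rfl
      obtain ⟨k, hk⟩ := hτ x
      have hk' := hk _ (hm k).1
      by_cases hki : k = i
      · subst hki
        exact absurd (hy.1 k hij) (not_lt.2 hk')
      · exact absurd (hx.1 k hki) (not_lt.2 hk')
    rw [← card_pair hxy]
    congr 1
    ext z
    simp only [mem_filter, mem_univ, true_and, h, mem_insert, mem_singleton]
    constructor
    · rintro (hz | hz)
      exacts [Or.inl (hz.unique (hr i) hx), Or.inr (hz.unique (hr j) hy)]
    · rintro (rfl | rfl)
      exacts [Or.inl hx, Or.inr hy]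
  · rw [← card_singleton x]
    congr 1
    ext z
    simp only [mem_filter, mem_univ, true_and, h, mem_singleton]
    constructor
    · rintro (hz | hz)
      exacts [hz.unique (hr i) hx, absurd ⟨z, hz.1⟩ hj]
    · rintro rfl
      exact Or.inl hx

/-- The facets of a non-rainbow set that miss only the colour `i₀` come in pairs. -/
theorem even_card_facets [DecidableEq I] (c : T → I) (i₀ : I) {σ : Finset T}
    (hσ : σ.card = Fintype.card I) (h : σ.image c ≠ univ) :
    Even (σ.filter fun a => (σ.erase a).image c = univ.erase i₀).card := by
  rcases (σ.filter fun a => (σ.erase a).image c = univ.erase i₀).eq_empty_or_nonempty with h0 | ⟨a, ha⟩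
  · simp [h0]
  obtain ⟨haσ, ha⟩ := mem_filter.1 ha
  have himg : σ.image c = insert (c a) (univ.erase i₀) := by
    rw [← ha, ← image_insert, insert_erase haσ]
  have hca : c a ∈ (σ.erase a).image c := by
    rw [ha, mem_erase]
    refine ⟨fun hca => h ?_, mem_univ _⟩
    rw [himg, hca, insert_erase (mem_univ _)]
  obtain ⟨b, hb, hcb⟩ := mem_image.1 hca
  -- The facet has `card I - 1` elements and as many colours. So `b` is the only other element with
  -- the colour of `a`, and only `a` and `b` can be removed without losing a colour.
  have hinj : Set.InjOn c (σ.erase a) := by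
    rw [← card_image_iff, ha, card_erase_of_mem haσ, card_erase_of_mem (mem_univ _), hσ, card_univ]
  have hba : b ≠ a := (mem_erase.1 hb).1
  have hbσ : b ∈ σ := (mem_erase.1 hb).2
  have hb' : (σ.erase b).image c = univ.erase i₀ := by
    rw [← ha]
    ext k
    simp only [mem_image, mem_erase]
    constructor
    · rintro ⟨x, ⟨hxb, hx⟩, rfl⟩
      by_cases hxa : x = a
      · exact ⟨b, ⟨hba, hbσ⟩, by rw [hxa, hcb]⟩
      · exact ⟨x, ⟨hxa, hx⟩, rfl⟩
    · rintro ⟨x, ⟨hxa, hx⟩, rfl⟩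
      by_cases hxb : x = b
      · exact ⟨a, ⟨hba.symm, haσ⟩, by rw [hxb, hcb]⟩
      · exact ⟨x, ⟨hxb, hx⟩, rfl⟩
  have : (σ.filter fun a => (σ.erase a).image c = univ.erase i₀) = {b, a} := by
    ext x
    simp only [mem_filter, mem_insert, mem_singleton]
    constructor
    · rintro ⟨hxσ, hx⟩
      by_contra! hne
      have hcx : c x ∈ (σ.erase x).image c := by
        rw [hx, ← ha]
        exact mem_image_of_mem _ (mem_erase.2 ⟨hne.2, hxσ⟩)
      obtain ⟨y, hy, hyx⟩ := mem_image.1 hcx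
      obtain ⟨hyne, hyσ⟩ := mem_erase.1 hy
      by_cases hya : y = a
      · subst hya
        exact hne.1 (hinj (mem_coe.2 (mem_erase.2 ⟨hne.2, hxσ⟩)) (mem_coe.2 hb) (by rw [hcb, hyx]))
      · exact hyne (hinj (mem_coe.2 (mem_erase.2 ⟨hya, hyσ⟩))
          (mem_coe.2 (mem_erase.2 ⟨hne.2, hxσ⟩)) hyx)
    · rintro (rfl | rfl)
      exacts [⟨hbσ, hb'⟩, ⟨haσ, ha⟩]
  rw [this, card_pair hba]
  exact even_two

/-- **Scarf's lemma** in combinatorial form: a set `T` with a family of linear orders, each `i` of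
which has a slack element `e i` below everything in the `i`-th order and above all non-slack
elements in the others, has for every colouring extending `e i ↦ i` a dominating set that meets
every colour exactly once. -/
theorem exists_dominating_image_eq_univ [Fintype T] [DecidableEq I]
    (hr : ∀ i, Function.Injective (r i)) (e : I → T) (hmin : ∀ i t, r i (e i) ≤ r i t)
    (hslack : ∀ i j t, j ≠ i → t ∉ Set.range e → r i t < r i (e j))
    (c : T → I) (hc : ∀ i, c (e i) = i) (hI : 2 ≤ Fintype.card I) :
    ∃ σ : Finset T, Dominating r σ ∧ σ.card = Fintype.card I ∧ σ.image c = univ := by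
  classical
  by_contra! hcon
  have he : Function.Injective e := Function.LeftInverse.injective hc
  have hmin' : ∀ i t, t ≠ e i → r i (e i) < r i t := fun i t ht =>
    lt_of_le_of_ne (hmin i t) fun h => ht (hr i h).symm
  obtain ⟨i₀⟩ : Nonempty I := Fintype.card_pos_iff.1 (by omega)
  -- Doors `D` carry every colour but `i₀`; rooms `R` are the full-size dominating sets. Incidences
  -- are counted in two ways; without a rainbow room, each room has an even number of doors.
  let D : Finset (Finset T) := univ.filter fun τ =>
    Dominating r τ ∧ τ.card + 1 = Fintype.card I ∧ τ.image c = univ.erase i₀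
  let R : Finset (Finset T) := univ.filter fun σ => Dominating r σ ∧ σ.card = Fintype.card I
  have hcount := sum_card_bipartiteAbove_eq_sum_card_bipartiteBelow (s := D) (t := R)
    (fun τ σ => τ ⊆ σ)
  have hrooms : ∀ σ ∈ R, Even (D.bipartiteBelow (fun τ σ => τ ⊆ σ) σ).card := by
    intro σ hσ
    obtain ⟨hdom, hcard⟩ := (mem_filter.1 hσ).2
    have : D.bipartiteBelow (fun τ σ => τ ⊆ σ) σ =
        (σ.filter fun a => (σ.erase a).image c = univ.erase i₀).image σ.erase := by
      ext τ
      simp only [bipartiteBelow, D, mem_filter, mem_univ, true_and, mem_image]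
      constructor
      · rintro ⟨⟨-, h2, h3⟩, hτ⟩
        obtain ⟨a, ha⟩ := card_eq_one.1 (by rw [card_sdiff_of_subset hτ]; omega : (σ \ τ).card = 1)
        have haσ : a ∈ σ := (mem_sdiff.1 (ha ▸ mem_singleton_self a)).1
        have : σ.erase a = τ := by
          rw [← sdiff_singleton_eq_erase, ← ha, Finset.sdiff_sdiff_eq_self hτ]
        exact ⟨a, ⟨haσ, this ▸ h3⟩, this⟩
      · rintro ⟨a, ⟨haσ, h3⟩, rfl⟩
        refine ⟨⟨hdom.mono (erase_subset _ _), ?_, h3⟩, erase_subset _ _⟩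
        rw [card_erase_add_one haσ, hcard]
    rw [this, card_image_of_injOn]
    · exact even_card_facets c i₀ hcard (hcon σ hdom hcard)
    · intro a ha b _ hab
      exact (erase_injOn σ) (mem_filter.1 ha).1 (by aesop) hab
  have hext : ∀ τ ∈ D, (R.bipartiteAbove (fun τ σ => τ ⊆ σ) τ).card =
      (univ.filter fun x => x ∉ τ ∧ Dominating r (insert x τ)).card := by
    intro τ hτ
    obtain ⟨hdom, hcard, -⟩ := (mem_filter.1 hτ).2
    have : R.bipartiteAbove (fun τ σ => τ ⊆ σ) τ =
        (univ.filter fun x => x ∉ τ ∧ Dominating r (insert x τ)).image fun x => insert x τ := by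
      ext σ
      simp only [bipartiteAbove, R, mem_filter, mem_univ, true_and, mem_image]
      constructor
      · rintro ⟨⟨h1, h2⟩, hτσ⟩
        obtain ⟨a, ha⟩ := card_eq_one.1 (by rw [card_sdiff_of_subset hτσ]; omega : (σ \ τ).card = 1)
        have haσ := mem_sdiff.1 (ha ▸ mem_singleton_self a : a ∈ σ \ τ)
        have : insert a τ = σ := by
          rw [insert_eq, ← ha, sdiff_union_of_subset hτσ]
        exact ⟨a, ⟨haσ.2, this ▸ h1⟩, this⟩
      · rintro ⟨x, ⟨hx, h1⟩, rfl⟩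
        exact ⟨⟨h1, by rw [card_insert_of_notMem hx, hcard]⟩, subset_insert _ _⟩
    rw [this, card_image_of_injOn]
    intro x hx y _ hxy
    have hx' : x ∈ insert y τ := by
      rw [← show insert x τ = insert y τ from hxy]
      exact mem_insert_self _ _
    exact (mem_insert.1 hx').resolve_right (mem_filter.1 hx).2.1
  -- The outer door, the only one consisting of slack elements; it lies in one room, every other
  -- door in two.
  let τ₀ : Finset T := (univ.erase i₀).image e
  have hτ₀ : τ₀ ∈ D := by
    refine mem_filter.2 ⟨mem_univ _, fun t => ?_, ?_, ?_⟩
    · by_cases ht : t ∈ Set.range e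
      · obtain ⟨k, rfl⟩ := ht
        exact ⟨k, fun x _ => hmin k x⟩
      · refine ⟨i₀, fun x hx => ?_⟩
        obtain ⟨j, hj, rfl⟩ := mem_image.1 hx
        exact (hslack i₀ j t (mem_erase.1 hj).1 ht).le
    · rw [card_image_of_injective _ he, card_erase_add_one (mem_univ _), card_univ]
    · rw [image_image, show c ∘ e = id from funext hc, image_id]
  have hother : ∀ τ ∈ D.erase τ₀, Even (R.bipartiteAbove (fun τ σ => τ ⊆ σ) τ).card := by
    intro τ hτ
    obtain ⟨hne, hτD⟩ := mem_erase.1 hτ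
    rw [hext τ hτD]
    obtain ⟨hdom, hcard, himg⟩ := (mem_filter.1 hτD).2
    have hτne : τ.Nonempty := card_pos.1 (by omega)
    obtain ⟨m, hm⟩ := exists_minimizers r hτne
    obtain ⟨i, j, hij, -, hiff⟩ := hdom.exists_extension_iff hr hcard hm
    -- A non-slack `t ∈ τ` bounds every threshold from above, so `e i` passes all thresholds but the
    -- `i`-th: both replacements exist.
    obtain ⟨t, ht, hreg⟩ : ∃ t ∈ τ, t ∉ Set.range e := by
      by_contra! hall
      refine hne (eq_of_subset_of_card_le (fun t ht => ?_) ?_)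
      · obtain ⟨k, rfl⟩ := hall t ht
        refine mem_image_of_mem _ ?_
        rw [← himg]
        exact mem_image.2 ⟨e k, ht, hc k⟩
      · have := (mem_filter.1 hτ₀).2.2.1
        omega
    have hex : ∀ i, ∃ x, ∀ k, k ≠ i → r k (m k) < r k x := fun i =>
      ⟨e i, fun k hk => ((hm k).2 t ht).trans_lt (hslack k i t hk.symm hreg)⟩
    rw [card_extensions hr hij hiff hdom hm (hex i), if_pos (hex j)]
    exact even_two
  have houter : (R.bipartiteAbove (fun τ σ => τ ⊆ σ) τ₀).card = 1 := by
    rw [hext τ₀ hτ₀]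
    obtain ⟨hdom, hcard, -⟩ := (mem_filter.1 hτ₀).2
    have hτne : τ₀.Nonempty := card_pos.1 (by omega)
    obtain ⟨m, hm⟩ := exists_minimizers r hτne
    have hmk : ∀ k, k ≠ i₀ → m k = e k := fun k hk => hr k <| le_antisymm
      ((hm k).2 _ (mem_image_of_mem _ (mem_erase.2 ⟨hk, mem_univ _⟩))) (hmin k _)
    -- The minimizers at indices other than `i₀` are distinct slacks, so the coinciding pair must
    -- involve `i₀`.
    obtain ⟨j, hj, hmj, hiff⟩ : ∃ j, i₀ ≠ j ∧ m i₀ = m j ∧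
        ∀ x, (x ∉ τ₀ ∧ Dominating r (insert x τ₀)) ↔
          (IsReplacement r m i₀ x ∨ IsReplacement r m j x) := by
      obtain ⟨i, j, hij, hmij, hiff⟩ := hdom.exists_extension_iff hr hcard hm
      by_cases hi : i = i₀
      · exact ⟨j, hi ▸ hij, hi ▸ hmij, hi ▸ hiff⟩
      by_cases hj : j = i₀
      · exact ⟨i, hj ▸ hij.symm, hj ▸ hmij.symm, fun x => by rw [hiff x, or_comm, hj]⟩
      · rw [hmk i hi, hmk j hj] at hmij
        exact absurd (he hmij) hij
    rw [hmk j hj.symm] at hmj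
    rw [card_extensions hr hj hiff hdom hm ⟨e i₀, fun k hk => ?_⟩, if_neg]
    -- No replacement exists at `j`: `x` would have to exceed `e j` in order `i₀`. This excludes
    -- non-slacks, `e j` and `e i₀`, while any other `e k` is its own threshold.
    · rintro ⟨x, hx⟩
      have h0 := hx i₀ hj
      rw [hmj] at h0
      by_cases hxr : x ∈ Set.range e
      · obtain ⟨k, rfl⟩ := hxr
        by_cases hkj : k = j
        · exact absurd h0 (by rw [hkj]; exact lt_irrefl _)
        by_cases hk : k = i₀
        · exact absurd h0 (not_lt.2 (hk ▸ hmin k _))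
        · exact absurd (hx k hkj) (by rw [hmk k hk]; exact lt_irrefl _)
      · exact absurd h0 (not_lt.2 (hslack i₀ j x hj.symm hxr).le)
    · rw [hmk k hk]
      exact hmin' k _ fun h => hk (he h).symm
  -- The count by doors is one plus an even number; the count by rooms is even.
  rw [← add_sum_erase D _ hτ₀, houter] at hcount
  have h1 := even_sum _ hother
  have h2 := even_sum _ hrooms
  rw [← hcount] at h2
  rw [Nat.even_add] at h2
  exact absurd (h2.2 h1) (by decide)

end Scarf

/-! ### Brouwer's theorem on a simplex. -/

namespace Brouwer

variable {ι : Type*} [Fintype ι] [DecidableEq ι]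

/-- Every colouring of the integer points of a dilated simplex has a nonempty set of points such
that no grid point beats it strictly in all the coordinates that occur as its colours. -/
theorem exists_dominating_grid_set (hι : 2 ≤ Fintype.card ι) (K : ℕ)
    (c : (piAntidiag (univ : Finset ι) K) → ι) :
    ∃ σ : Finset (piAntidiag (univ : Finset ι) K), σ.Nonempty ∧
      ∀ t : piAntidiag (univ : Finset ι) K, ∃ i ∈ σ.image c, ∀ x ∈ σ, t.1 i ≤ x.1 i := by
  classical
  let X := piAntidiag (univ : Finset ι) K
  let M : ℕ := Fintype.card X
  let eX : X ≃ Fin M := Fintype.equivFin X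
  let eι := Fintype.equivFin ι
  have hle : ∀ (x : X) i, x.1 i ≤ K := fun x i => by
    rw [← (mem_piAntidiag.1 x.2).1]
    exact single_le_sum (f := x.1) (fun _ _ => Nat.zero_le _) (mem_univ i)
  obtain ⟨i₀⟩ : Nonempty ι := Fintype.card_pos_iff.1 (by omega)
  have t₀ : X := ⟨Pi.single i₀ K, mem_piAntidiag.2 ⟨by simp, fun _ _ => mem_univ _⟩⟩
  -- Order `i` compares `i`-th coordinates, breaking ties by an enumeration with values below `M`.
  -- Grid ranks lie in `[0, (K + 1) * M)`, below every foreign slack and above the own slack at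
  -- `-1`.
  let r : ι → X ⊕ ι → ℤ := fun i => Sum.elim (fun x => (x.1 i : ℤ) * M + (eX x : ℕ))
    fun j => if j = i then -1 else ((K : ℤ) + 1) * M + (eι j : ℕ)
  have hinl : ∀ i x, 0 ≤ r i (.inl x) ∧ r i (.inl x) < ((K : ℤ) + 1) * M := fun i x => by
    have h1 : ((eX x : ℕ) : ℤ) < M := by exact_mod_cast (eX x).2
    have h2 : (x.1 i : ℤ) ≤ K := by exact_mod_cast hle x i
    simp only [r, Sum.elim_inl]
    constructor
    · positivity
    · nlinarith
  have hinr : ∀ i j, j ≠ i → ((K : ℤ) + 1) * M ≤ r i (.inr j) := fun i j hj => by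
    simp only [r, Sum.elim_inr, if_neg hj]
    omega
  have hself : ∀ i, r i (.inr i) = -1 := fun i => by simp [r]
  have hmono : ∀ i (x y : X), r i (.inl x) ≤ r i (.inl y) → x.1 i ≤ y.1 i := fun i x y h => by
    simp only [r, Sum.elim_inl] at h
    have h1 : ((eX y : ℕ) : ℤ) < M := by exact_mod_cast (eX y).2
    by_contra! hlt
    have h2 : (y.1 i : ℤ) + 1 ≤ x.1 i := by exact_mod_cast hlt
    nlinarith [(eX x : ℕ).cast_nonneg (α := ℤ)]
  have hM : 0 ≤ ((K : ℤ) + 1) * M := by positivity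
  have hr : ∀ i, Function.Injective (r i) := by
    intro i
    rintro (x | j) (y | k) h
    · have hxy : x.1 i = y.1 i := le_antisymm (hmono i x y h.le) (hmono i y x h.ge)
      simp only [r, Sum.elim_inl, hxy, add_right_inj, Nat.cast_inj] at h
      rw [eX.injective (Fin.ext h)]
    · by_cases hk : k = i
      · have := hinl i x
        rw [h, hk, hself] at this
        omega
      · have := (hinl i x).2
        have := hinr i k hk
        omega
    · by_cases hk : j = i
      · have := hinl i y
        rw [← h, hk, hself] at this
        omega
      · have := (hinl i y).2
        have := hinr i j hk
        omega
    · by_cases hj : j = i <;> by_cases hk : k = i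
      · rw [hj, hk]
      · have := hinr i k hk
        rw [← h, hj, hself] at this
        omega
      · have := hinr i j hj
        rw [h, hk, hself] at this
        omega
      · simp only [r, Sum.elim_inr, if_neg hj, if_neg hk, add_right_inj, Nat.cast_inj] at h
        rw [eι.injective (Fin.ext h)]
  have hneg : ∀ i t, -1 ≤ r i t := by
    rintro i (x | j)
    · have := (hinl i x).1
      omega
    · by_cases hj : j = i
      · rw [hj, hself]
      · have := hinr i j hj
        omega
  obtain ⟨σ, hdom, -, himg⟩ := Scarf.exists_dominating_image_eq_univ hr Sum.inr
    (fun i t => by rw [hself]; exact hneg i t)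
    (fun i j t hj ht => by
      rcases t with x | k
      · exact (hinl i x).2.trans_le (hinr i j hj)
      · exact absurd ⟨k, rfl⟩ ht)
    (Sum.elim c id) (fun _ => rfl) hι
  -- An index dominating a grid point cannot have its own slack in `σ`, since that slack has rank
  -- `-1`. Its colour must then come from a grid point.
  have key : ∀ t : X, ∃ i, .inr i ∉ σ ∧ ∀ x, .inl x ∈ σ → t.1 i ≤ x.1 i := by
    intro t
    obtain ⟨i, hi⟩ := hdom (.inl t)
    refine ⟨i, fun h => ?_, fun x hx => hmono i t x (hi _ hx)⟩
    have h1 := hi _ h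
    have h2 := (hinl i t).1
    rw [hself] at h1
    omega
  have hcol : ∀ i, .inr i ∉ σ → ∃ x, .inl x ∈ σ ∧ c x = i := by
    intro i hi
    obtain ⟨t, ht, hti⟩ := mem_image.1 (himg ▸ mem_univ i)
    rcases t with x | k
    · exact ⟨x, ht, hti⟩
    · exact absurd ((show k = i from hti) ▸ ht) hi
  refine ⟨univ.filter fun x => .inl x ∈ σ, ?_, fun t => ?_⟩
  · obtain ⟨i, hi, -⟩ := key t₀
    obtain ⟨x, hx, -⟩ := hcol i hi
    exact ⟨x, by simpa using hx⟩
  · obtain ⟨i, hi, hle⟩ := key t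
    obtain ⟨x, hx, hcx⟩ := hcol i hi
    exact ⟨i, mem_image.2 ⟨x, by simpa using hx, hcx⟩, fun y hy => hle y (by simpa using hy)⟩

/-- Every colouring of the integer points of a dilated simplex has a cluster of nearby points such
that each colour either occurs in the cluster or has a small coordinate throughout the cluster. -/
theorem exists_grid_cluster (hι : 2 ≤ Fintype.card ι) (K : ℕ)
    (c : (piAntidiag (univ : Finset ι) K) → ι) :
    ∃ σ : Finset (piAntidiag (univ : Finset ι) K), σ.Nonempty ∧
      (∀ x ∈ σ, ∀ y ∈ σ, ∀ i, x.1 i ≤ y.1 i + Fintype.card ι) ∧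
      ∀ i, (∃ y ∈ σ, c y = i) ∨ ∀ x ∈ σ, x.1 i ≤ Fintype.card ι := by
  obtain ⟨σ, hσ, hdom⟩ := exists_dominating_grid_set hι K c
  set C := σ.image c with hC
  have hCcard : C.card ≤ Fintype.card ι := card_le_univ C
  choose m hmσ hm using fun i => σ.exists_min_image (fun x => x.1 i) hσ
  have hsum : ∀ x : piAntidiag (univ : Finset ι) K, ∑ i, x.1 i = K := fun x =>
    (mem_piAntidiag.1 x.2).1
  have hbound : K < ∑ i ∈ C, ((m i).1 i + 1) := by
    by_contra! hle
    obtain ⟨i₀, hi₀⟩ : C.Nonempty := hσ.image c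
    -- If the sum were at most `K`, this grid point, with the surplus placed at `i₀`, would beat the
    -- minimum in every coordinate of `C`.
    let t : ι → ℕ := fun i => (if i ∈ C then (m i).1 i + 1 else 0) +
      (Pi.single i₀ (K - ∑ i ∈ C, ((m i).1 i + 1)) : ι → ℕ) i
    have ht : t ∈ piAntidiag (univ : Finset ι) K := by
      refine mem_piAntidiag.2 ⟨?_, fun _ _ => mem_univ _⟩
      simp only [t, sum_add_distrib, sum_ite_mem, univ_inter, sum_pi_single', mem_univ, if_true]
      rw [← sum_add_distrib]
      omega
    obtain ⟨i, hi, hti⟩ := hdom ⟨t, ht⟩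
    have := hti _ (hmσ i)
    simp only [t, if_pos hi] at this
    omega
  rw [sum_add_distrib, sum_const, smul_eq_mul, mul_one] at hbound
  -- The minima over `C` already use all but fewer than `C.card` of the total `K`, leaving little
  -- for any excess or for coordinates outside `C`.
  have hinC : ∀ x ∈ σ, ∀ i ∈ C, x.1 i < (m i).1 i + Fintype.card ι := by
    intro x hx i hi
    have h1 : ∑ j ∈ C, x.1 j ≤ K := by
      refine le_of_le_of_eq ?_ (hsum x)
      exact sum_le_sum_of_subset (subset_univ _)
    rw [← add_sum_erase _ _ hi] at h1 hbound
    have h2 : ∑ j ∈ C.erase i, (m j).1 j ≤ ∑ j ∈ C.erase i, x.1 j := sum_le_sum fun j _ => hm j x hx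
    omega
  have hnotC : ∀ x ∈ σ, ∀ i, i ∉ C → x.1 i < Fintype.card ι := by
    intro x hx i hi
    have h1 : x.1 i + ∑ j ∈ C, x.1 j ≤ K := by
      refine le_of_le_of_eq ?_ (hsum x)
      rw [← sum_insert hi]
      exact sum_le_sum_of_subset (subset_univ _)
    have h2 : ∑ j ∈ C, (m j).1 j ≤ ∑ j ∈ C, x.1 j := sum_le_sum fun j _ => hm j x hx
    omega
  refine ⟨σ, hσ, fun x hx y hy i => ?_, fun i => ?_⟩
  · by_cases hi : i ∈ C
    · have h1 := hinC x hx i hi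
      have h2 := hm i y hy
      omega
    · have := hnotC x hx i hi
      omega
  · by_cases hi : i ∈ C
    · exact Or.inl (by simpa [hC] using hi)
    · exact Or.inr fun x hx => (hnotC x hx i hi).le

/-- Approximate fixed points of a continuous self-map of the simplex. -/
theorem exists_le_add (hι : 2 ≤ Fintype.card ι) {f : stdSimplex ℝ ι → stdSimplex ℝ ι}
    (hf : Continuous f) {ε : ℝ} (hε : 0 < ε) :
    ∃ z : stdSimplex ℝ ι, ∀ i, z.1 i ≤ (f z).1 i + 2 * ε := by
  obtain ⟨δ, hδ, hfδ⟩ := Metric.uniformContinuous_iff.1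
    (CompactSpace.uniformContinuous_of_continuous hf) ε hε
  obtain ⟨K, hK⟩ := exists_nat_gt (Fintype.card ι / min δ ε)
  have hmin : 0 < min δ ε := lt_min hδ hε
  have hn : (0 : ℝ) < Fintype.card ι := by exact_mod_cast (by omega : 0 < Fintype.card ι)
  have hK0 : (0 : ℝ) < K := (div_pos hn hmin).trans hK
  have hsmall : Fintype.card ι / (K : ℝ) < min δ ε := by
    rw [div_lt_iff₀ hK0, mul_comm]
    rwa [div_lt_iff₀ hmin] at hK
  let p : piAntidiag (univ : Finset ι) K → stdSimplex ℝ ι := fun x =>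
    ⟨fun i => x.1 i / K, fun i => by positivity, by
      rw [← sum_div, ← Nat.cast_sum, (mem_piAntidiag.1 x.2).1, div_self hK0.ne']⟩
  -- Colour a grid point by a coordinate that `f` does not decrease; one exists because both
  -- coordinate sums are `1`.
  have hcol : ∀ x, ∃ i, (p x).1 i ≤ (f (p x)).1 i := fun x => by
    obtain ⟨i, -, hi⟩ := exists_le_of_sum_le (s := univ)
      (Finset.univ_nonempty_iff.2 (Fintype.card_pos_iff.1 (by omega)))
      (((p x).2.2.trans (f (p x)).2.2.symm).le)
    exact ⟨i, hi⟩
  choose c hc using hcol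
  obtain ⟨σ, ⟨x, hx⟩, hclose, hcov⟩ := exists_grid_cluster hι K c
  have hpclose : ∀ x ∈ σ, ∀ y ∈ σ, ∀ i, (p x).1 i ≤ (p y).1 i + Fintype.card ι / (K : ℝ) := by
    intro x hx y hy i
    simp only [p]
    rw [← add_div]
    have : (x.1 i : ℝ) ≤ y.1 i + Fintype.card ι := by exact_mod_cast hclose x hx y hy i
    gcongr
  refine ⟨p x, fun i => ?_⟩
  -- Either a nearby `y` has colour `i`, and passing to `y` and back costs `ε` each way, or the
  -- coordinate itself is below `ε`.
  rcases hcov i with ⟨y, hy, rfl⟩ | h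
  · have hd : dist (p x) (p y) < δ := by
      refine lt_of_le_of_lt ?_ (hsmall.trans_le (min_le_left _ _))
      rw [Subtype.dist_eq, dist_pi_le_iff (by positivity)]
      intro i
      rw [Real.dist_eq, abs_le]
      constructor <;> linarith [hpclose x hx y hy i, hpclose y hy x hx i]
    have h1 := hfδ hd
    have h2 := (dist_le_pi_dist (f (p x)).1 (f (p y)).1 (c y)).trans_lt h1
    rw [Real.dist_eq, abs_lt] at h2
    linarith [hpclose x hx y hy (c y), hc y, hsmall.trans_le (min_le_right _ _)]
  · have h1 : (p x).1 i ≤ Fintype.card ι / (K : ℝ) := by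
      have : (x.1 i : ℝ) ≤ Fintype.card ι := by exact_mod_cast h x hx
      simp only [p]
      gcongr
    linarith [(f (p x)).2.1 i, hsmall.trans_le (min_le_right _ _)]

/-- **Brouwer's fixed point theorem** for the standard simplex. -/
theorem exists_fixedPoint [Nonempty ι] {f : stdSimplex ℝ ι → stdSimplex ℝ ι}
    (hf : Continuous f) : ∃ z, f z = z := by
  obtain ⟨i₀⟩ := ‹Nonempty ι›
  have z₀ : stdSimplex ℝ ι := ⟨Pi.single i₀ 1, single_mem_stdSimplex ℝ i₀⟩
  rcases Nat.lt_or_ge (Fintype.card ι) 2 with hι | hι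
  · have : Subsingleton ι := Fintype.card_le_one_iff_subsingleton.1 (by omega)
    have h1 : ∀ z : stdSimplex ℝ ι, ∀ i, z.1 i = 1 := fun z i => by
      have := z.2.2
      rwa [Fintype.sum_subsingleton _ i] at this
    exact ⟨z₀, Subtype.ext (funext fun i => by rw [h1, h1])⟩
  -- Approximate fixed points force the minimum of this total excess to be zero; then `z ≤ f z`
  -- coordinatewise, and equal sums give equality.
  let φ : stdSimplex ℝ ι → ℝ := fun z => ∑ i, max 0 (z.1 i - (f z).1 i)
  have hφ : Continuous φ := by
    have h1 : ∀ i, Continuous fun z : stdSimplex ℝ ι => z.1 i := fun i =>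
      (continuous_apply i).comp continuous_subtype_val
    exact continuous_finsetSum _ fun i _ => continuous_const.max ((h1 i).sub ((h1 i).comp hf))
  obtain ⟨z, -, hz⟩ := isCompact_univ.exists_isMinOn ⟨z₀, Set.mem_univ _⟩ hφ.continuousOn
  have hφz : φ z ≤ 0 := by
    refine le_of_forall_pos_le_add fun ε hε => ?_
    have hn : (0 : ℝ) < Fintype.card ι := by exact_mod_cast (by omega : 0 < Fintype.card ι)
    obtain ⟨w, hw⟩ := exists_le_add hι hf (ε := ε / (2 * Fintype.card ι)) (by positivity)
    calc φ z ≤ φ w := hz (Set.mem_univ w)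
      _ ≤ ∑ _i : ι, ε / Fintype.card ι := by
        refine sum_le_sum fun i _ => max_le (by positivity) ?_
        have := hw i
        have h2 : 2 * (ε / (2 * Fintype.card ι)) = ε / Fintype.card ι := by field_simp
        linarith
      _ = 0 + ε := by
        rw [sum_const, card_univ, nsmul_eq_mul, zero_add]
        field_simp
  have hle : ∀ i, z.1 i ≤ (f z).1 i := fun i => by
    have h1 : max 0 (z.1 i - (f z).1 i) ≤ φ z :=
      single_le_sum (f := fun i => max 0 (z.1 i - (f z).1 i)) (fun _ _ => le_max_left _ _)
        (mem_univ i)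
    linarith [le_max_right 0 (z.1 i - (f z).1 i)]
  refine ⟨z, Subtype.ext (funext fun i => ?_)⟩
  exact ((sum_eq_sum_iff_of_le fun i _ => hle i).1 (z.2.2.trans (f z).2.2.symm) i (mem_univ i)).symm

end Brouwer

/-! ### Products of simplices and Nash's theorem. -/

namespace Brouwer

variable {κ : Type*} {B : κ → Type*} [Fintype κ] [∀ k, Fintype (B k)]

theorem continuous_stdSimplex_apply {ι : Type*} [Fintype ι] (i : ι) :
    Continuous fun z : stdSimplex ℝ ι => z.1 i :=
  (continuous_apply i).comp continuous_subtype_val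

/-- The block-averaging embedding of a product of simplices into the simplex over the disjoint
union. -/
noncomputable def joinBlocks [Nonempty κ] (x : ∀ k, stdSimplex ℝ (B k)) :
    stdSimplex ℝ (Σ k, B k) :=
  ⟨fun p => (x p.1).1 p.2 / Fintype.card κ,
    fun p => div_nonneg ((x p.1).2.1 _) (by positivity), by
      have h0 : (Fintype.card κ : ℝ) ≠ 0 := by positivity
      have h1 : ∀ k, ∑ b, (x k).1 b = 1 := fun k => (x k).2.2
      rw [← sum_div, Fintype.sum_sigma, div_eq_one_iff_eq h0]
      simp [h1]⟩

theorem continuous_joinBlocks [Nonempty κ] :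
    Continuous (joinBlocks : (∀ k, stdSimplex ℝ (B k)) → stdSimplex ℝ (Σ k, B k)) :=
  Continuous.subtype_mk (continuous_pi fun p : Σ k, B k =>
    ((continuous_stdSimplex_apply p.2).comp (continuous_apply p.1)).div_const _) _

variable [∀ k, Nonempty (B k)]

/-- The point of the product of simplices obtained from a point of the simplex over the disjoint
union by topping up the light blocks uniformly and rescaling each block. -/
noncomputable def normalizeBlocks [Nonempty κ] (y : stdSimplex ℝ (Σ k, B k)) (k : κ) :
    stdSimplex ℝ (B k) :=
  have hn : (0 : ℝ) < 1 / Fintype.card κ := by positivity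
  have hpos : 0 < max (∑ b, y.1 ⟨k, b⟩) (1 / Fintype.card κ : ℝ) := lt_max_of_lt_right hn
  ⟨fun b => (y.1 ⟨k, b⟩ + max 0 (1 / Fintype.card κ - ∑ b, y.1 ⟨k, b⟩) / Fintype.card (B k)) /
      max (∑ b, y.1 ⟨k, b⟩) (1 / Fintype.card κ),
    fun b => div_nonneg (add_nonneg (y.2.1 _) (by positivity)) hpos.le, by
      have h0 : (Fintype.card (B k) : ℝ) ≠ 0 := by positivity
      rw [← sum_div, sum_add_distrib, sum_const, card_univ, nsmul_eq_mul, mul_div_cancel₀ _ h0,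
        div_eq_one_iff_eq hpos.ne']
      rcases le_total (∑ b, y.1 ⟨k, b⟩) (1 / Fintype.card κ : ℝ) with h | h
      · rw [max_eq_right h, max_eq_right (sub_nonneg.2 h), add_sub_cancel]
      · rw [max_eq_left h, max_eq_left (sub_nonpos.2 h), add_zero]⟩

theorem continuous_normalizeBlocks [Nonempty κ] :
    Continuous (normalizeBlocks : stdSimplex ℝ (Σ k, B k) → ∀ k, stdSimplex ℝ (B k)) := by
  refine continuous_pi fun k => Continuous.subtype_mk (continuous_pi fun b => ?_) _
  have hs : Continuous fun y : stdSimplex ℝ (Σ k, B k) => ∑ b, y.1 ⟨k, b⟩ :=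
    continuous_finsetSum _ fun b _ => continuous_stdSimplex_apply _
  have hn : (0 : ℝ) < 1 / Fintype.card κ := by positivity
  exact ((continuous_stdSimplex_apply _).add
    ((continuous_const.max (continuous_const.sub hs)).div_const _)).div
      (hs.max continuous_const) fun y => (lt_max_of_lt_right hn).ne'

/-- Joined blocks all have mass exactly `1 / card κ`, so only the rescaling acts. This makes the
product a retract of one simplex and transfers the fixed-point property. -/
theorem normalizeBlocks_joinBlocks [Nonempty κ] (x : ∀ k, stdSimplex ℝ (B k)) :
    normalizeBlocks (joinBlocks x) = x := by
  funext k
  refine Subtype.ext (funext fun b => ?_)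
  have h0 : (Fintype.card κ : ℝ) ≠ 0 := by positivity
  have h1 : ∑ b, (x k).1 b = 1 := (x k).2.2
  have h2 : ∑ b, (joinBlocks x).1 ⟨k, b⟩ = 1 / Fintype.card κ := by
    simp only [joinBlocks]
    rw [← sum_div, h1]
  simp only [normalizeBlocks, h2, sub_self, max_self, zero_div, add_zero]
  simp only [joinBlocks]
  field_simp

/-- **Brouwer's fixed point theorem** for a finite product of simplices. -/
theorem exists_fixedPoint_pi {f : (∀ k, stdSimplex ℝ (B k)) → ∀ k, stdSimplex ℝ (B k)}
    (hf : Continuous f) : ∃ x, f x = x := by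
  classical
  have x₀ : ∀ k, stdSimplex ℝ (B k) := fun k =>
    ⟨Pi.single (Classical.arbitrary (B k)) 1, single_mem_stdSimplex ℝ _⟩
  rcases isEmpty_or_nonempty κ with hκ | hκ
  · exact ⟨x₀, Subsingleton.elim _ _⟩
  have : Nonempty (Σ k, B k) := ⟨⟨Classical.arbitrary κ, Classical.arbitrary _⟩⟩
  obtain ⟨y, hy⟩ := exists_fixedPoint
    (continuous_joinBlocks.comp (hf.comp (continuous_normalizeBlocks (B := B))))
  refine ⟨normalizeBlocks y, ?_⟩
  conv_rhs => rw [← hy]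
  exact (normalizeBlocks_joinBlocks _).symm

/-- **Nash's theorem** for continuous payoffs of pure strategies: some mixed profile gives every
pure strategy at most the average payoff. -/
theorem exists_equilibrium (Q : ∀ k, B k → (∀ k, stdSimplex ℝ (B k)) → ℝ)
    (hQ : ∀ k b, Continuous (Q k b)) :
    ∃ x : ∀ k, stdSimplex ℝ (B k), ∀ k b, Q k b x ≤ ∑ b', (x k).1 b' * Q k b' x := by
  let u : ∀ _ : κ, (∀ k, stdSimplex ℝ (B k)) → ℝ := fun k x => ∑ b, (x k).1 b * Q k b x
  let g : ∀ k, B k → (∀ k, stdSimplex ℝ (B k)) → ℝ := fun k b x => max 0 (Q k b x - u k x)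
  have happ : ∀ k b, Continuous fun x : ∀ k, stdSimplex ℝ (B k) => (x k).1 b := fun k b =>
    (continuous_stdSimplex_apply b).comp (continuous_apply k)
  have hu : ∀ k, Continuous (u k) := fun k =>
    continuous_finsetSum _ fun b _ => (happ k b).mul (hQ k b)
  have hg : ∀ k b, Continuous (g k b) := fun k b => continuous_const.max ((hQ k b).sub (hu k))
  have hg0 : ∀ k b x, 0 ≤ g k b x := fun k b x => le_max_left _ _
  have hG : ∀ k x, 0 < 1 + ∑ b, g k b x := fun k x =>
    add_pos_of_pos_of_nonneg one_pos (sum_nonneg fun b _ => hg0 k b x)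
  -- Nash's map: add to each strategy its gain over the average, then renormalize.
  let f : (∀ k, stdSimplex ℝ (B k)) → ∀ k, stdSimplex ℝ (B k) := fun x k =>
    ⟨fun b => ((x k).1 b + g k b x) / (1 + ∑ b, g k b x),
      fun b => div_nonneg (add_nonneg ((x k).2.1 b) (hg0 k b x)) (hG k x).le, by
        have h1 : ∑ b, (x k).1 b = 1 := (x k).2.2
        rw [← sum_div, sum_add_distrib, h1, div_self (hG k x).ne']⟩
  have hf : Continuous f := by
    refine continuous_pi fun k => Continuous.subtype_mk (continuous_pi fun b => ?_) _
    exact ((happ k b).add (hg k b)).div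
      (continuous_const.add (continuous_finsetSum _ fun b _ => hg k b)) fun x => (hG k x).ne'
  obtain ⟨x, hx⟩ := exists_fixedPoint_pi hf
  refine ⟨x, fun k => ?_⟩
  have hfix : ∀ b, (x k).1 b * ∑ b, g k b x = g k b x := fun b => by
    have h1 : ((x k).1 b + g k b x) / (1 + ∑ b, g k b x) = (x k).1 b :=
      congrFun (congrArg Subtype.val (congrFun hx k)) b
    rw [div_eq_iff (hG k x).ne'] at h1
    linarith
  -- At a fixed point the gains are proportional to the mixed strategy, under which the mean of `Q -
  -- u` is zero.
  have hsq : ∑ b, g k b x * g k b x = 0 := by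
    have h1 : ∀ b, g k b x * g k b x = g k b x * (Q k b x - u k x) := fun b => by
      rcases le_total 0 (Q k b x - u k x) with h | h
      · simp only [g, max_eq_right h]
      · simp only [g, max_eq_left h, zero_mul]
    have h2 : ∑ b, (x k).1 b * (Q k b x - u k x) = 0 := by
      have h3 : ∑ b, (x k).1 b = 1 := (x k).2.2
      simp only [mul_sub, sum_sub_distrib]
      rw [← sum_mul, h3, one_mul]
      exact sub_self _
    calc ∑ b, g k b x * g k b x
        = ∑ b, (∑ b, g k b x) * ((x k).1 b * (Q k b x - u k x)) := sum_congr rfl fun b _ => by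
          rw [h1, ← mul_assoc, mul_comm (∑ b, g k b x), hfix]
      _ = 0 := by rw [← mul_sum, h2, mul_zero]
  intro b
  have h1 := (sum_eq_zero_iff_of_nonneg fun b _ => mul_self_nonneg (g k b x)).1 hsq b (mem_univ b)
  have h2 : max 0 (Q k b x - u k x) = 0 := mul_self_eq_zero.1 h1
  exact sub_nonpos.1 (max_eq_left_iff.1 h2)

end Brouwer

noncomputable section

namespace RMG

/-! ### Worst cases over total variation balls. -/

section WorstCase

variable {X : Type*} [Fintype X]

/-- Worst expectation of `V` over the total variation ball of radius `σ` around `p`. -/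
def worstCase (σ : ℝ) (V p : X → ℝ) : ℝ :=
  ⨅ q : {q : stdSimplex ℝ X // tvDist q.1 p ≤ σ}, ∑ x, q.1.1 x * V x

theorem tvDist_self (p : X → ℝ) : tvDist p p = 0 := by simp [tvDist]

theorem tvDist_nonneg (p q : X → ℝ) : 0 ≤ tvDist p q :=
  mul_nonneg (by norm_num) (sum_nonneg fun _ _ => abs_nonneg _)

theorem tvDist_comm (p q : X → ℝ) : tvDist p q = tvDist q p := by
  simp only [tvDist, abs_sub_comm]

theorem tvDist_triangle (p q r : X → ℝ) : tvDist p r ≤ tvDist p q + tvDist q r := by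
  simp only [tvDist]
  rw [← mul_add, ← sum_add_distrib]
  gcongr
  exact abs_sub_le _ _ _

theorem tvDist_eq_mul {t : ℝ} (ht : 0 ≤ t) {p q p' q' : X → ℝ}
    (h : ∀ x, p x - q x = t * (p' x - q' x) ∨ p x - q x = -(t * (p' x - q' x))) :
    tvDist p q = t * tvDist p' q' := by
  simp only [tvDist]
  rw [mul_left_comm]
  congr 1
  rw [mul_sum]
  refine sum_congr rfl fun x _ => ?_
  rw [abs_eq_abs.2 (h x), abs_mul, abs_of_nonneg ht]

theorem continuous_tvDist_left (p : X → ℝ) : Continuous fun q : stdSimplex ℝ X => tvDist q.1 p :=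
  continuous_const.mul (continuous_finsetSum _ fun x _ =>
    ((Brouwer.continuous_stdSimplex_apply x).sub continuous_const).abs)

variable {σ : ℝ} {V p : X → ℝ}

/-- The ball is compact and contains its centre, so the linear objective attains its minimum. -/
theorem exists_worstCase_eq (hσ : 0 ≤ σ) (hp : p ∈ stdSimplex ℝ X) (V : X → ℝ) :
    ∃ q : stdSimplex ℝ X, tvDist q.1 p ≤ σ ∧ (∑ x, q.1 x * V x = worstCase σ V p) ∧
      ∀ q' : stdSimplex ℝ X, tvDist q'.1 p ≤ σ → ∑ x, q.1 x * V x ≤ ∑ x, q'.1 x * V x := by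
  have hcl : IsClosed {q : stdSimplex ℝ X | tvDist q.1 p ≤ σ} :=
    isClosed_le (continuous_tvDist_left p) continuous_const
  have hne : (⟨p, hp⟩ : stdSimplex ℝ X) ∈ {q : stdSimplex ℝ X | tvDist q.1 p ≤ σ} :=
    (tvDist_self p).trans_le hσ
  obtain ⟨q, hq, hmin⟩ := hcl.isCompact.exists_isMinOn ⟨_, hne⟩
    (f := fun q : stdSimplex ℝ X => ∑ x, q.1 x * V x)
    (continuous_finsetSum _ fun x _ =>
      (Brouwer.continuous_stdSimplex_apply x).mul continuous_const).continuousOn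
  refine ⟨q, hq, ?_, fun q' hq' => hmin hq'⟩
  have : Nonempty {q : stdSimplex ℝ X // tvDist q.1 p ≤ σ} := ⟨⟨q, hq⟩⟩
  refine le_antisymm (le_ciInf fun q' => hmin q'.2) ?_
  refine ciInf_le (f := fun q : {q : stdSimplex ℝ X // tvDist q.1 p ≤ σ} => ∑ x, q.1.1 x * V x)
    ⟨∑ x, q.1 x * V x, ?_⟩ ⟨q, hq⟩
  rintro _ ⟨q', rfl⟩
  exact hmin q'.2

theorem worstCase_le (hσ : 0 ≤ σ) (hp : p ∈ stdSimplex ℝ X) {q : stdSimplex ℝ X}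
    (hq : tvDist q.1 p ≤ σ) : worstCase σ V p ≤ ∑ x, q.1 x * V x := by
  obtain ⟨q', -, h, hmin⟩ := exists_worstCase_eq hσ hp V
  exact h ▸ hmin q hq

theorem worstCase_mono (hσ : 0 ≤ σ) (hp : p ∈ stdSimplex ℝ X) {V' : X → ℝ}
    (h : ∀ x, V x ≤ V' x) : worstCase σ V p ≤ worstCase σ V' p := by
  obtain ⟨q, hq, heq, -⟩ := exists_worstCase_eq hσ hp V'
  rw [← heq]
  exact (worstCase_le hσ hp hq).trans
    (sum_le_sum fun x _ => mul_le_mul_of_nonneg_left (h x) (q.2.1 x))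

/-- The total variation ball around a probability vector moves by at most as much as its centre. -/
theorem exists_mem_ball_near (hσ : 0 ≤ σ) {p p' : X → ℝ} (hp : p ∈ stdSimplex ℝ X)
    {q' : stdSimplex ℝ X} (hq' : tvDist q'.1 p' ≤ σ) :
    ∃ q : stdSimplex ℝ X, tvDist q.1 p ≤ σ ∧ tvDist q.1 q'.1 ≤ tvDist p p' := by
  have hε := tvDist_nonneg p p'
  -- At radius zero take `p` itself; this keeps `σ + ε` nonzero below.
  rcases hσ.eq_or_lt with h0 | hpos
  · refine ⟨⟨p, hp⟩, (tvDist_self p).trans_le hσ, ?_⟩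
    refine (tvDist_triangle p p' q'.1).trans ?_
    rw [tvDist_comm p' q'.1]
    linarith
  set ε := tvDist p p'
  have hd : tvDist q'.1 p ≤ σ + ε := by
    refine (tvDist_triangle q'.1 p' p).trans ?_
    rw [tvDist_comm p' p]
    exact add_le_add hq' le_rfl
  have hs : 0 < σ + ε := by linarith
  -- Slide `q'` towards `p`: their distance is at most `σ + ε`, and these weights split it into at
  -- most `σ` and at most `ε`.
  have hmem : (σ / (σ + ε)) • q'.1 + (ε / (σ + ε)) • p ∈ stdSimplex ℝ X :=
    convex_stdSimplex ℝ X q'.2 hp (by positivity) (by positivity) (by field_simp)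
  refine ⟨⟨_, hmem⟩, ?_, ?_⟩
  · have h1 : tvDist ((σ / (σ + ε)) • q'.1 + (ε / (σ + ε)) • p) p
        = σ / (σ + ε) * tvDist q'.1 p := by
      refine tvDist_eq_mul (by positivity) fun x => Or.inl ?_
      simp only [Pi.add_apply, Pi.smul_apply, smul_eq_mul]
      field_simp
      ring
    calc _ = σ / (σ + ε) * tvDist q'.1 p := h1
      _ ≤ σ / (σ + ε) * (σ + ε) := by gcongr
      _ = σ := by field_simp
  · have h1 : tvDist ((σ / (σ + ε)) • q'.1 + (ε / (σ + ε)) • p) q'.1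
        = ε / (σ + ε) * tvDist q'.1 p := by
      refine tvDist_eq_mul (by positivity) fun x => Or.inr ?_
      simp only [Pi.add_apply, Pi.smul_apply, smul_eq_mul]
      field_simp
      ring
    calc _ = ε / (σ + ε) * tvDist q'.1 p := h1
      _ ≤ ε / (σ + ε) * (σ + ε) := by gcongr
      _ = ε := by field_simp

/-- Move the minimizer for `(V', p')` into the ball around `p`; the two error terms pay for moving
the centre and for changing the objective. -/
theorem worstCase_le_add (hσ : 0 ≤ σ) {p p' : X → ℝ} (hp : p ∈ stdSimplex ℝ X)
    (hp' : p' ∈ stdSimplex ℝ X) (V V' : X → ℝ) :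
    worstCase σ V p ≤
      worstCase σ V' p' + (2 * tvDist p p' * ∑ x, |V' x| + ∑ x, |V x - V' x|) := by
  obtain ⟨q', hq', heq, -⟩ := exists_worstCase_eq hσ hp' V'
  obtain ⟨q, hq, hqq⟩ := exists_mem_ball_near hσ hp hq'
  have h1 : ∑ x, q.1 x * V x =
      ∑ x, q'.1 x * V' x + (∑ x, (q.1 x - q'.1 x) * V' x + ∑ x, q.1 x * (V x - V' x)) := by
    rw [← sum_add_distrib, ← sum_add_distrib]
    exact sum_congr rfl fun x _ => by ring
  have h2 : ∑ x, (q.1 x - q'.1 x) * V' x ≤ 2 * tvDist p p' * ∑ x, |V' x| := by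
    calc ∑ x, (q.1 x - q'.1 x) * V' x ≤ ∑ x, |q.1 x - q'.1 x| * ∑ y, |V' y| := by
          refine sum_le_sum fun x _ => (le_abs_self _).trans ?_
          rw [abs_mul]
          gcongr
          exact single_le_sum (f := fun y => |V' y|) (fun _ _ => abs_nonneg _) (mem_univ x)
      _ = 2 * tvDist q.1 q'.1 * ∑ y, |V' y| := by
          rw [← sum_mul, tvDist]
          ring
      _ ≤ _ := by
          gcongr
  have h3 : ∑ x, q.1 x * (V x - V' x) ≤ ∑ x, |V x - V' x| := by
    refine sum_le_sum fun x _ => (le_abs_self _).trans ?_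
    rw [abs_mul, abs_of_nonneg (q.2.1 x)]
    exact mul_le_of_le_one_left (abs_nonneg _) (stdSimplex.le_one q x)
  have h4 := worstCase_le (V := V) hσ hp hq
  linarith

theorem continuous_worstCase {Y : Type*} [TopologicalSpace Y] (hσ : 0 ≤ σ) {V p : Y → X → ℝ}
    (hp : ∀ y, p y ∈ stdSimplex ℝ X) (hpc : Continuous p) (hVc : Continuous V) :
    Continuous fun y => worstCase σ (V y) (p y) := by
  refine continuous_iff_continuousAt.2 fun y₀ => ?_
  -- A bound symmetric enough for both directions of `worstCase_le_add`, hence both sums of absolute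
  -- values.
  let b : Y → ℝ := fun y =>
    2 * tvDist (p y) (p y₀) * (∑ x, |V y₀ x| + ∑ x, |V y x|) + ∑ x, |V y x - V y₀ x|
  have hb : Continuous b := by
    have hV : ∀ x, Continuous fun y => V y x := fun x => (continuous_apply x).comp hVc
    have hP : ∀ x, Continuous fun y => p y x := fun x => (continuous_apply x).comp hpc
    simp only [b, tvDist]
    fun_prop
  have hb0 : Filter.Tendsto b (nhds y₀) (nhds 0) := by
    have := hb.tendsto y₀
    simpa [b, tvDist_self] using this
  refine tendsto_iff_dist_tendsto_zero.2 (squeeze_zero (fun _ => dist_nonneg) (fun y => ?_) hb0)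
  have h1 := worstCase_le_add hσ (hp y) (hp y₀) (V y) (V y₀)
  have h2 := worstCase_le_add hσ (hp y₀) (hp y) (V y₀) (V y)
  rw [tvDist_comm (p y₀)] at h2
  simp only [abs_sub_comm (V y₀ _)] at h2
  have h3 : 0 ≤ 2 * tvDist (p y) (p y₀) := mul_nonneg (by norm_num) (tvDist_nonneg _ _)
  have h4 : 0 ≤ 2 * tvDist (p y) (p y₀) * ∑ x, |V y x| :=
    mul_nonneg h3 (sum_nonneg fun _ _ => abs_nonneg _)
  have h5 : 0 ≤ 2 * tvDist (p y) (p y₀) * ∑ x, |V y₀ x| :=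
    mul_nonneg h3 (sum_nonneg fun _ _ => abs_nonneg _)
  rw [Real.dist_eq, abs_le]
  simp only [b, mul_add]
  constructor <;> linarith

end WorstCase

end RMG

end

noncomputable section

namespace RMG

/-! ### Trajectory sums and the Bellman equation. -/

section Trajectories

variable {X S : Type*} {m : ℕ}

theorem statePath_zero (s : S) (ω : Fin m → X × S) : statePath s ω 0 = s := rfl

theorem statePath_cons_succ (s : S) (x : X × S) (ω : Fin m → X × S) (j : Fin (m + 1)) :
    statePath s (Fin.cons x ω : Fin (m + 1) → X × S) j.succ = statePath x.2 ω j := by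
  refine Fin.cases ?_ (fun k => ?_) j <;> simp [statePath]

theorem sum_fin_cons {Y : Type*} [Fintype Y] (F : (Fin (m + 1) → Y) → ℝ) :
    ∑ ω, F ω = ∑ x, ∑ ω : Fin m → Y, F (Fin.cons x ω) := by
  rw [← (Fin.consEquiv fun _ => Y).sum_comp, Fintype.sum_prod_type]
  rfl

variable [Fintype X] [Fintype S]

/-- Expected total reward of random trajectories of length `m`, for step-dependent transition
weights `w` and rewards `ρ`. -/
def pathSum (m : ℕ) (w : Fin m → S → X × S → ℝ) (ρ : Fin m → S → X → ℝ) (s : S) : ℝ :=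
  ∑ ω : Fin m → X × S, (∏ k, w k (statePath s ω k.castSucc) (ω k)) *
    ∑ k, ρ k (statePath s ω k.castSucc) (ω k).1

theorem sum_prod_statePath (w : Fin m → S → X × S → ℝ) (hw : ∀ k s, ∑ x, w k s x = 1) (s : S) :
    ∑ ω : Fin m → X × S, ∏ k, w k (statePath s ω k.castSucc) (ω k) = 1 := by
  induction m generalizing s with
  | zero => simp
  | succ m ih =>
    rw [sum_fin_cons]
    simp only [Fin.prod_univ_succ, Fin.cons_zero, Fin.cons_succ,
      Fin.castSucc_zero, statePath_zero, ← Fin.succ_castSucc, statePath_cons_succ, ← mul_sum]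
    simp only [ih (fun k => w k.succ) (fun k => hw k.succ), mul_one, hw]

/-- Split off the first transition; the remaining weights total one, so the first reward factors
out. -/
theorem pathSum_succ (w : Fin (m + 1) → S → X × S → ℝ) (ρ : Fin (m + 1) → S → X → ℝ)
    (hw : ∀ k s, ∑ x, w k s x = 1) (s : S) :
    pathSum (m + 1) w ρ s = ∑ x, w 0 s x *
      (ρ 0 s x.1 + pathSum m (fun k => w k.succ) (fun k => ρ k.succ) x.2) := by
  rw [pathSum, sum_fin_cons]
  refine sum_congr rfl fun x _ => ?_
  simp only [Fin.prod_univ_succ, Fin.sum_univ_succ, Fin.cons_zero,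
    Fin.cons_succ, Fin.castSucc_zero, statePath_zero, ← Fin.succ_castSucc, statePath_cons_succ]
  simp only [mul_assoc, ← mul_sum, mul_add, sum_add_distrib]
  rw [← sum_mul, sum_prod_statePath (fun k => w k.succ) (fun k => hw k.succ), one_mul]
  rfl

theorem pathSum_cast {n : ℕ} (e : n = m) (w : Fin n → S → X × S → ℝ) (ρ : Fin n → S → X → ℝ)
    (s : S) : pathSum n w ρ s =
      pathSum m (fun k => w (Fin.cast e.symm k)) (fun k => ρ (Fin.cast e.symm k)) s := by
  subst e
  rfl

end Trajectories

namespace Game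

variable {N S : Type*} {A : N → Type*} {H : ℕ} [Fintype S] [Fintype N] [DecidableEq N]
  [∀ i, Fintype (A i)]

theorem value_eq_pathSum (G : Game N S A H) (i : N) (π : JointPolicy N S A H)
    (P : Fin H → S → A i → stdSimplex ℝ S) (h : ℕ) (s : S) :
    G.value i π P h s = pathSum (H - h)
      (fun k s x => (π (stepAt h k) s).1 x.1 * (P (stepAt h k) s (x.1 i)).1 x.2)
      (fun k s a => G.reward i (stepAt h k) s a) s := by
  simp only [value, trajectoryProb, pathSum]
  rfl

theorem value_of_le (G : Game N S A H) (i : N) (π : JointPolicy N S A H)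
    (P : Fin H → S → A i → stdSimplex ℝ S) {h : ℕ} (hh : H ≤ h) (s : S) :
    G.value i π P h s = 0 := by
  rw [value_eq_pathSum, pathSum_cast (Nat.sub_eq_zero_of_le hh)]
  simp [pathSum]

/-- Bellman equation for a fixed kernel. -/
theorem value_eq (G : Game N S A H) (i : N) (π : JointPolicy N S A H)
    (P : Fin H → S → A i → stdSimplex ℝ S) (h : Fin H) (s : S) :
    G.value i π P h s = ∑ a, (π h s).1 a *
      (G.reward i h s a + ∑ s', (P h s (a i)).1 s' * G.value i π P (h + 1) s') := by
  have hm : H - h = (H - (h + 1)) + 1 := by omega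
  have hP : ∀ t s a, ∑ s', (P t s a).1 s' = 1 := fun t s a => (P t s a).2.2
  have hπ : ∀ t s, ∑ a, (π t s).1 a = 1 := fun t s => (π t s).2.2
  rw [value_eq_pathSum, pathSum_cast hm, pathSum_succ]
  · rw [Fintype.sum_prod_type]
    refine sum_congr rfl fun a _ => ?_
    have h0 : stepAt (h : ℕ) (Fin.cast hm.symm 0) = h := Fin.ext (by simp [stepAt])
    have hs : ∀ k : Fin (H - (h + 1)), stepAt (h : ℕ) (Fin.cast hm.symm k.succ) =
        stepAt (h + 1) k := fun k => Fin.ext (by simp [stepAt]; omega)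
    simp only [h0, hs, ← value_eq_pathSum]
    simp only [mul_assoc, ← mul_sum, mul_add, sum_add_distrib]
    rw [← sum_mul, hP, one_mul]
  · intro k s
    rw [Fintype.sum_prod_type]
    simp only [← mul_sum, hP, mul_one, hπ]

end Game

/-! ### Marginals and deviations of product policies. -/

section ProductPolicies

variable {N S : Type*} {A : N → Type*} {H : ℕ} [Fintype N] [DecidableEq N] [∀ i, Fintype (A i)]

/-- Probability that the agents other than `i` play `a₋ᵢ` under a product policy. -/
def ProductPolicy.others (π : ProductPolicy N S A H) (i : N) (h : Fin H) (s : S)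
    (a : ∀ j, A j) : ℝ :=
  ∏ j ∈ univ.erase i, (π j h s).1 (a j)

variable (π : ProductPolicy N S A H) (i : N) (h : Fin H) (s : S)

theorem ProductPolicy.others_nonneg (a : ∀ j, A j) : 0 ≤ π.others i h s a :=
  prod_nonneg fun j _ => (π j h s).2.1 _

theorem ProductPolicy.toJoint_eq (a : ∀ j, A j) :
    (π.toJoint h s).1 a = (π i h s).1 (a i) * π.others i h s a :=
  (mul_prod_erase univ (fun j => (π j h s).1 (a j)) (mem_univ i)).symm

theorem ProductPolicy.others_update_action (a : ∀ j, A j) (b : A i) :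
    π.others i h s (Function.update a i b) = π.others i h s a :=
  prod_congr rfl fun j hj => by rw [Function.update_of_ne (mem_erase.1 hj).1]

theorem ProductPolicy.others_update (π' : AgentPolicy N S A H i) :
    ProductPolicy.others (Function.update π i π') i = π.others i := by
  funext h s a
  exact prod_congr rfl fun j hj => by rw [Function.update_of_ne (mem_erase.1 hj).1]

theorem othersMarginal_toJoint (a : ∀ j, A j) :
    othersMarginal π.toJoint i h s a = π.others i h s a := by
  have h1 : ∑ b, (π i h s).1 b = 1 := (π i h s).2.2
  simp only [othersMarginal, π.toJoint_eq i, Function.update_self, π.others_update_action]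
  rw [← sum_mul, h1, one_mul]

theorem deviate_toJoint (π' : AgentPolicy N S A H i) :
    deviate π.toJoint i π' = ProductPolicy.toJoint (Function.update π i π') := by
  funext h s
  refine Subtype.ext (funext fun a => ?_)
  rw [ProductPolicy.toJoint_eq _ i, ProductPolicy.others_update, Function.update_self,
    ← othersMarginal_toJoint]
  rfl

variable [∀ i, DecidableEq (A i)]

/-- With independent agents, a recommendation tells nothing about the others, so modifying it only
pushes agent `i`'s own law forward. -/
theorem modify_toJoint (f : StrategyModification N S A H i) :
    modify π.toJoint i f = ProductPolicy.toJoint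
      (Function.update π i fun h s => stdSimplex.map (f h s) (π i h s)) := by
  funext h s
  refine Subtype.ext (funext fun a => ?_)
  rw [ProductPolicy.toJoint_eq _ i, ProductPolicy.others_update, Function.update_self]
  have h1 : (stdSimplex.map (f h s) (π i h s)).1 (a i) =
      ∑ b, if f h s b = a i then (π i h s).1 b else 0 := by
    have := congrFun (stdSimplex.map_coe (f h s) (π i h s)) (a i)
    rw [FunOnFinite.linearMap_apply_apply] at this
    exact this.trans (sum_filter _ _)
  rw [h1, sum_mul]
  refine sum_congr rfl fun b _ => ?_
  rw [π.toJoint_eq i, Function.update_self, π.others_update_action, ite_mul, zero_mul]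

/-- This is the total mass of the product policy in which agent `i` surely plays `ai`. -/
theorem ProductPolicy.sum_others (ai : A i) :
    (∑ a, if a i = ai then π.others i h s a else 0) = 1 := by
  have h1 : ∑ a, (ProductPolicy.toJoint
      (Function.update π i fun _ _ => stdSimplex.vertex ai) h s).1 a = 1 :=
    (ProductPolicy.toJoint _ h s).2.2
  rw [← h1]
  refine sum_congr rfl fun a _ => ?_
  rw [ProductPolicy.toJoint_eq _ i, ProductPolicy.others_update, Function.update_self]
  have h2 : (stdSimplex.vertex (S := ℝ) ai).1 (a i) = if a i = ai then 1 else 0 :=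
    (congrFun (stdSimplex.vertex_coe (S := ℝ) ai) (a i)).trans (Pi.single_apply _ _ _)
  rw [h2, ite_mul, one_mul, zero_mul]

theorem agentMarginal_toJoint (ai : A i) : agentMarginal π.toJoint i h s ai = (π i h s).1 ai := by
  rw [← mul_one ((π i h s).1 ai), ← π.sum_others i h s ai, mul_sum]
  refine sum_congr rfl fun a _ => ?_
  split_ifs with ha
  · rw [π.toJoint_eq i, ha]
  · rw [mul_zero]

/-- The convention at null actions gives the same answer as division elsewhere, so the uncertainty
set ignores agent `i`'s own policy. -/
theorem othersConditional_toJoint (a : ∀ j, A j) :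
    othersConditional π.toJoint i h s a = π.others i h s a := by
  rw [othersConditional, agentMarginal_toJoint, othersMarginal_toJoint, π.toJoint_eq i]
  split_ifs with h0
  · rfl
  · rw [mul_div_cancel_left₀ _ h0]

/-- Expectation over the actions of all agents as an iterated expectation. -/
theorem ProductPolicy.sum_toJoint_mul (F : (∀ j, A j) → ℝ) :
    ∑ a, (π.toJoint h s).1 a * F a =
      ∑ ai, (π i h s).1 ai * ∑ a, if a i = ai then π.others i h s a * F a else 0 := by
  simp only [mul_sum]
  rw [sum_comm]
  refine sum_congr rfl fun a _ => ?_
  simp only [mul_ite, mul_zero]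
  rw [sum_ite_eq, if_pos (mem_univ _), π.toJoint_eq i, mul_assoc]

end ProductPolicies

end RMG

end

noncomputable section

namespace RMG

/-! ### Robust Bellman recursion and equilibria. -/

namespace Game

theorem expect_pure {N S : Type*} {A : N → Type*} {H : ℕ} [∀ i, Fintype (A i)]
    (π : ProductPolicy N S A H) (F : ProductPolicy N S A H → ℝ) :
    expect (PMF.pure π) F = F π := by
  rw [expect, tsum_eq_single π]
  · simp
  · intro π' h
    simp [PMF.pure_apply, h]

variable {N S : Type*} {A : N → Type*} {H : ℕ} [Fintype S] [Fintype N] [DecidableEq N]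
  [∀ i, Fintype (A i)] [∀ i, DecidableEq (A i)]

theorem nominalGiven_toJoint (G : Game N S A H) (π : ProductPolicy N S A H) (i : N) (h : Fin H)
    (s : S) (ai : A i) (s' : S) : G.nominalGiven i π.toJoint h s ai s' =
      ∑ a, if a i = ai then π.others i h s a * (G.nominal h s a).1 s' else 0 := by
  simp only [nominalGiven, othersConditional_toJoint]

theorem nominalGiven_toJoint_mem (G : Game N S A H) (π : ProductPolicy N S A H) (i : N)
    (h : Fin H) (s : S) (ai : A i) : G.nominalGiven i π.toJoint h s ai ∈ stdSimplex ℝ S := by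
  refine ⟨fun s' => ?_, ?_⟩
  · rw [nominalGiven_toJoint]
    refine sum_nonneg fun a _ => ?_
    split_ifs
    exacts [mul_nonneg (π.others_nonneg i h s a) ((G.nominal h s a).2.1 s'), le_rfl]
  · simp only [nominalGiven_toJoint]
    rw [sum_comm, ← π.sum_others i h s ai]
    refine sum_congr rfl fun a _ => ?_
    have h1 : ∑ s', (G.nominal h s a).1 s' = 1 := (G.nominal h s a).2.2
    split_ifs
    · rw [← mul_sum, h1, mul_one]
    · exact sum_const_zero

/-- Robust payoff of agent `i` for playing `ai` in state `s` at step `h` against the others' part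
of `π`, when the continuation is worth `V`. -/
def robustQ (G : Game N S A H) (i : N) (π : ProductPolicy N S A H) (h : Fin H) (s : S)
    (V : S → ℝ) (ai : A i) : ℝ :=
  ∑ a, if a i = ai then π.others i h s a *
    (G.reward i h s a + worstCase (G.radius i) V (G.nominalGiven i π.toJoint h s (a i))) else 0

/-- For a fixed continuation, both the weights and the ball centres involve only the other agents.
-/
theorem robustQ_update (G : Game N S A H) (i : N) (π : ProductPolicy N S A H)
    (π' : AgentPolicy N S A H i) : G.robustQ i (Function.update π i π') = G.robustQ i π := by
  funext h s V ai
  have h1 : G.nominalGiven i (ProductPolicy.toJoint (Function.update π i π')) =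
      G.nominalGiven i π.toJoint := by
    funext h s ai s'
    simp only [nominalGiven_toJoint, ProductPolicy.others_update]
  simp only [robustQ, h1, ProductPolicy.others_update]

theorem robustQ_mono (G : Game N S A H) (i : N) (π : ProductPolicy N S A H) (h : Fin H) (s : S)
    {V V' : S → ℝ} (hV : ∀ s, V s ≤ V' s) (ai : A i) :
    G.robustQ i π h s V ai ≤ G.robustQ i π h s V' ai := by
  refine sum_le_sum fun a _ => ?_
  split_ifs
  · exact mul_le_mul_of_nonneg_left (add_le_add le_rfl (worstCase_mono (G.radius_nonneg i)
      (G.nominalGiven_toJoint_mem π i h s _) hV)) (π.others_nonneg i h s a)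
  · exact le_rfl

/-- Robust value of a product policy, computed by backward induction. -/
def backwardValue (G : Game N S A H) (i : N) (π : ProductPolicy N S A H) (h : ℕ) (s : S) : ℝ :=
  if hh : h < H then
    ∑ ai, (π i ⟨h, hh⟩ s).1 ai *
      G.robustQ i π ⟨h, hh⟩ s (fun s' => G.backwardValue i π (h + 1) s') ai
  else 0
termination_by H - h

theorem backwardValue_eq (G : Game N S A H) (i : N) (π : ProductPolicy N S A H) (h : Fin H)
    (s : S) : G.backwardValue i π h s =
      ∑ ai, (π i h s).1 ai * G.robustQ i π h s (G.backwardValue i π (h + 1)) ai := by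
  rw [backwardValue, dif_pos h.2]

theorem backwardValue_of_le (G : Game N S A H) (i : N) (π : ProductPolicy N S A H) {h : ℕ}
    (hh : H ≤ h) (s : S) : G.backwardValue i π h s = 0 := by
  rw [backwardValue, dif_neg (not_lt.2 hh)]

theorem backwardValue_eq_sum_toJoint (G : Game N S A H) (i : N) (π : ProductPolicy N S A H)
    (h : Fin H) (s : S) : G.backwardValue i π h s = ∑ a, (π.toJoint h s).1 a *
      (G.reward i h s a + worstCase (G.radius i) (G.backwardValue i π (h + 1))
        (G.nominalGiven i π.toJoint h s (a i))) := by
  rw [backwardValue_eq, π.sum_toJoint_mul i]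
  rfl

/-- Downward induction over the steps of the game, for statements that hold after the horizon. -/
theorem backward_induction {p : ℕ → Prop} (hend : ∀ h, H ≤ h → p h)
    (hstep : ∀ h : Fin H, p (h + 1) → p h) (h : ℕ) : p h := by
  rcases Nat.lt_or_ge h H with hh | hh
  · exact Nat.decreasingInduction (motive := fun k _ => p k)
      (fun k hk ih => hstep ⟨k, hk⟩ ih) (hend H le_rfl) hh.le
  · exact hend h hh

/-- Robust values of product policies satisfy the robust Bellman recursion: one kernel of the
uncertainty set is worst at all steps and states at once. -/
theorem robustValue_toJoint (G : Game N S A H) (i : N) (π : ProductPolicy N S A H) (h : ℕ)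
    (s : S) : G.robustValue i π.toJoint h s = G.backwardValue i π h s := by
  have hσ := G.radius_nonneg i
  have hmem := G.nominalGiven_toJoint_mem π i
  -- Choose a worst distribution separately at each `(h, s, ai)` against the backward continuation;
  -- rectangularity puts the resulting kernel in the uncertainty set.
  choose P hPball hPeq _ using fun h s ai =>
    exists_worstCase_eq hσ (hmem h s ai) (G.backwardValue i π (h + 1))
  have hattain : ∀ h s, G.value i π.toJoint P h s = G.backwardValue i π h s := fun h => by
    induction h using backward_induction (H := H) with
    | hend h hh =>
      intro s
      rw [value_of_le _ _ _ _ hh, backwardValue_of_le _ _ _ hh]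
    | hstep h ih =>
      intro s
      rw [value_eq, backwardValue_eq_sum_toJoint]
      simp only [ih, hPeq]
  have hlower : ∀ P' ∈ G.uncertaintySet i π.toJoint, ∀ h s,
      G.backwardValue i π h s ≤ G.value i π.toJoint P' h s := fun P' hP' h => by
    induction h using backward_induction (H := H) with
    | hend h hh =>
      intro s
      rw [value_of_le _ _ _ _ hh, backwardValue_of_le _ _ _ hh]
    | hstep h ih =>
      intro s
      rw [value_eq, backwardValue_eq_sum_toJoint]
      refine sum_le_sum fun a _ => mul_le_mul_of_nonneg_left (add_le_add le_rfl ?_)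
        ((π.toJoint h s).2.1 a)
      exact (worstCase_le hσ (hmem h s _) (hP' h s _)).trans
        (sum_le_sum fun s' _ => mul_le_mul_of_nonneg_left (ih s') ((P' h s (a i)).2.1 s'))
  have hP : P ∈ G.uncertaintySet i π.toJoint := hPball
  have : Nonempty (G.uncertaintySet i π.toJoint) := ⟨⟨P, hP⟩⟩
  refine le_antisymm ?_ (le_ciInf fun P' => hlower P'.1 P'.2 h s)
  rw [← hattain h s]
  refine ciInf_le (f := fun P : G.uncertaintySet i π.toJoint => G.value i π.toJoint P.1 h s)
    ⟨G.backwardValue i π h s, ?_⟩ ⟨P, hP⟩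
  rintro _ ⟨P', rfl⟩
  exact hlower P'.1 P'.2 h s

theorem continuous_robustQ (G : Game N S A H) (i : N) (h : Fin H) (s : S) (ai : A i)
    {V : ProductPolicy N S A H → S → ℝ} (hV : Continuous V) :
    Continuous fun π => G.robustQ i π h s (V π) ai := by
  have hothers : ∀ a, Continuous fun π : ProductPolicy N S A H => π.others i h s a := fun a => by
    refine continuous_finsetProd _ fun j _ => ?_
    exact (Brouwer.continuous_stdSimplex_apply (a j)).comp
      ((continuous_apply s).comp ((continuous_apply h).comp (continuous_apply j)))
  have hnom : ∀ ai, Continuous fun π : ProductPolicy N S A H =>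
      G.nominalGiven i π.toJoint h s ai := fun ai => by
    refine continuous_pi fun s' => ?_
    simp only [nominalGiven_toJoint]
    refine continuous_finsetSum _ fun a _ => ?_
    split_ifs
    exacts [(hothers a).mul continuous_const, continuous_const]
  refine continuous_finsetSum _ fun a _ => ?_
  split_ifs
  · exact (hothers a).mul (continuous_const.add (continuous_worstCase (G.radius_nonneg i)
      (fun π => G.nominalGiven_toJoint_mem π i h s _) (hnom _) hV))
  · exact continuous_const

theorem continuous_backwardValue (G : Game N S A H) (i : N) (h : ℕ) :
    Continuous fun π : ProductPolicy N S A H => G.backwardValue i π h := by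
  induction h using backward_induction (H := H) with
  | hend h hh =>
    refine continuous_pi fun s => ?_
    simp only [G.backwardValue_of_le i _ hh s]
    exact continuous_const
  | hstep h ih =>
    refine continuous_pi fun s => ?_
    simp only [backwardValue_eq]
    refine continuous_finsetSum _ fun ai _ => Continuous.mul ?_ (G.continuous_robustQ i h s ai ih)
    exact (Brouwer.continuous_stdSimplex_apply ai).comp
      ((continuous_apply s).comp ((continuous_apply h).comp (continuous_apply i)))

theorem bestResponseValue_toJoint (G : Game N S A H) (i : N) (π : ProductPolicy N S A H) (h : ℕ)
    (s : S) : G.bestResponseValue i π.toJoint h s =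
      ⨆ π' : AgentPolicy N S A H i, G.backwardValue i (Function.update π i π') h s := by
  simp only [bestResponseValue, deviate_toJoint, robustValue_toJoint]

/-- Values are continuous on a compact policy space; without boundedness the real supremum would
default to zero. -/
theorem bddAbove_backwardValue_update (G : Game N S A H) (i : N) (π : ProductPolicy N S A H)
    (h : ℕ) (s : S) : BddAbove (Set.range fun π' : AgentPolicy N S A H i =>
      G.backwardValue i (Function.update π i π') h s) := by
  refine (isCompact_range ?_).bddAbove
  exact (continuous_apply s).comp
    ((G.continuous_backwardValue i h).comp (continuous_const.update i continuous_id))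

/-- Every robust value of a unilateral deviation is at most the best response value. -/
theorem robustValue_update_le (G : Game N S A H) (i : N) (π : ProductPolicy N S A H)
    (π' : AgentPolicy N S A H i) (h : ℕ) (s : S) :
    G.robustValue i (ProductPolicy.toJoint (Function.update π i π')) h s ≤
      G.bestResponseValue i π.toJoint h s := by
  rw [robustValue_toJoint, bestResponseValue_toJoint]
  exact le_ciSup (G.bddAbove_backwardValue_update i π h s) π'

/-- If no single action improves on the robust value at any step and state, then no deviation
does. -/
theorem isRobustNE_of_robustQ_le (G : Game N S A H) (π : ProductPolicy N S A H)
    (hπ : ∀ i (h : Fin H) s ai,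
      G.robustQ i π h s (G.backwardValue i π (h + 1)) ai ≤ G.backwardValue i π h s) :
    G.IsRobustNE π := by
  have hdev : ∀ i (π' : AgentPolicy N S A H i) h s,
      G.backwardValue i (Function.update π i π') h s ≤ G.backwardValue i π h s := by
    intro i π' h
    induction h using backward_induction (H := H) with
    | hend h hh =>
      intro s
      rw [backwardValue_of_le _ _ _ hh, backwardValue_of_le _ _ _ hh]
    | hstep h ih =>
      intro s
      have h1 : ∑ ai, (π' h s).1 ai = 1 := (π' h s).2.2
      rw [backwardValue_eq, robustQ_update, Function.update_self]
      -- By induction the deviator's continuation is no better than under `π`; monotonicity of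
      -- `robustQ` then reduces to single-action deviations.
      calc _ ≤ ∑ ai, (π' h s).1 ai * G.backwardValue i π h s :=
            sum_le_sum fun ai _ => mul_le_mul_of_nonneg_left
              ((G.robustQ_mono i π h s ih ai).trans (hπ i h s ai)) ((π' h s).2.1 ai)
        _ = _ := by rw [← sum_mul, h1, one_mul]
  intro i h s
  refine le_antisymm ?_ ?_
  · have := G.robustValue_update_le i π (π i) h s
    rwa [Function.update_eq_self] at this
  · have : Nonempty (AgentPolicy N S A H i) := ⟨π i⟩
    rw [robustValue_toJoint, bestResponseValue_toJoint]
    exact ciSup_le fun π' => hdev i π' h s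

/-- All triples `(i, h, s)` play one static game, each payoff using the continuation from the same
profile, so no stagewise selection of equilibria is needed. -/
theorem exists_isRobustNE [∀ i, Nonempty (A i)] (G : Game N S A H) :
    ∃ π : ProductPolicy N S A H, G.IsRobustNE π := by
  let toPolicy : (∀ k : N × Fin H × S, stdSimplex ℝ (A k.1)) → ProductPolicy N S A H :=
    fun x i h s => x (i, h, s)
  have hcont : Continuous toPolicy :=
    continuous_pi fun i => continuous_pi fun h => continuous_pi fun s => continuous_apply _
  obtain ⟨x, hx⟩ := Brouwer.exists_equilibrium (κ := N × Fin H × S) (B := fun k => A k.1)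
    (fun k ai x => G.robustQ k.1 (toPolicy x) k.2.1 k.2.2
      (G.backwardValue k.1 (toPolicy x) (k.2.1 + 1)) ai)
    fun k ai => (G.continuous_robustQ k.1 k.2.1 k.2.2 ai
      (G.continuous_backwardValue k.1 _)).comp hcont
  refine ⟨toPolicy x, G.isRobustNE_of_robustQ_le _ fun i h s ai => ?_⟩
  rw [backwardValue_eq]
  exact hx (i, h, s) ai

theorem IsRobustNE.isRobustCCE {G : Game N S A H} {π : ProductPolicy N S A H}
    (hπ : G.IsRobustNE π) : G.IsRobustCCE π.toJoint :=
  fun i h s => (hπ i h s).ge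

theorem IsRobustNE.isRobustCE {G : Game N S A H} {π : ProductPolicy N S A H}
    (hπ : G.IsRobustNE π) : G.IsRobustCE π.toJoint := fun i f h s => by
  rw [hπ i h s, modify_toJoint]
  exact G.robustValue_update_le i π _ h s

theorem IsRobustNE.isMixedRobustCE {G : Game N S A H} {π : ProductPolicy N S A H}
    (hπ : G.IsRobustNE π) : G.IsMixedRobustCE (PMF.pure π) := fun i f h s => by
  simpa only [expect_pure] using hπ.isRobustCE i f h s

theorem IsRobustNE.isMixedRobustCCE {G : Game N S A H} {π : ProductPolicy N S A H}
    (hπ : G.IsRobustNE π) : G.IsMixedRobustCCE (PMF.pure π) := fun i h s => by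
  simpa only [expect_pure] using hπ.isRobustCCE i h s

end Game

end RMG

end

theorem mainTheorem1 {N S : Type*} {A : N → Type*} {H : ℕ}
    [Fintype N] [DecidableEq N] [Fintype S]
    [∀ i, Fintype (A i)] [∀ i, DecidableEq (A i)] [∀ i, Nonempty (A i)]
    (G : RMG.Game N S A H) :
    (∃ π : RMG.ProductPolicy N S A H, G.IsRobustNE π) ∧
    (∀ π : RMG.ProductPolicy N S A H, G.IsRobustNE π →
      G.IsRobustCE π.toJoint ∧ G.IsRobustCCE π.toJoint ∧
      G.IsMixedRobustCE (PMF.pure π) ∧ G.IsMixedRobustCCE (PMF.pure π)) ∧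
    (∃ π : RMG.JointPolicy N S A H, G.IsRobustCE π) ∧
    (∃ π : RMG.JointPolicy N S A H, G.IsRobustCCE π) ∧
    (∃ ξ : PMF (RMG.ProductPolicy N S A H), G.IsMixedRobustCE ξ) ∧
    (∃ ξ : PMF (RMG.ProductPolicy N S A H), G.IsMixedRobustCCE ξ) := by
  obtain ⟨π, hπ⟩ := G.exists_isRobustNE
  exact ⟨⟨π, hπ⟩,
    fun _ h => ⟨h.isRobustCE, h.isRobustCCE, h.isMixedRobustCE, h.isMixedRobustCCE⟩,
    ⟨_, hπ.isRobustCE⟩, ⟨_, hπ.isRobustCCE⟩, ⟨_, hπ.isMixedRobustCE⟩, ⟨_, hπ.isMixedRobustCCE⟩⟩
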